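/- Let $\mathbf k$ be a field of characteristic $0$, $k\ge 3$, and let $V$ be a $\mathbf k$-vector space with basis $w_1,\dots,w_k$. Let $q_{ij}\in\mathbf k^\times$ with $q_{ii}=1$, $q_{ji}=q_{ij}^{-1}$, and let $S=S_{\mathbf q}(V)=T(V)/(w_iw_j-q_{ij}w_jw_i)$. Let $G$ be a finite group acting on $S$ by algebra automorphisms with $g(w_i)=\chi_i(g)w_i$ for characters $\chi_i:G\to\mathbf k^\times$, and let $S\#G$ be the smash product, with multiplication $(a\#g)(b\#h)=a\,g(b)\#gh$. Let $q\in\mathbf k^\times$, and let $\sigma,D_1,D_2:S\#G\to S\#G$ be linear maps that make $S\#G$ an $H_q$-module algebra, i.e. $\sigma$ is bijective, $D_1D_2=D_2D_1$, $q\sigma D_\ell=D_\ell\sigma$, $D_1^n=D_2^n=0$ if $q$ is a primitive $n$-th root of unity with $n\ge2$, and for all $a,b$: $\sigma(ab)=\sigma(a)\sigma(b)$, $D_1(ab)=D_1(a)\sigma(b)+aD_1(b)$, $D_2(ab)=D_2(a)b+\sigma(a)D_2(b)$, $\sigma(1)=1$, $D_\ell(1)=0$. Suppose that $\sigma(w_i)=\lambda_iw_i$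 with $\lambda_i\in\mathbf k^\times$; that $\sigma(g)=\xi(g)g$ for $g\in G$, with a homomorphism $\xi:G\to\mathbf k^\times$; and that $$D_1(w_1)=P_1g_1,\quad D_1(w_i)=0\ (i\ne1),\quad D_2(w_2)=P_2g_2,\quad D_2(w_i)=0\ (i\neq2),\quad D_1(g)=D_2(g)=0\ (g\in G),$$ where $g_1,g_2\in G$ and $P_1,P_2$ lie in the subalgebra of $S$ generated by $w_3,\dots,w_k$ and are such that $P_\ell w_j$ is a scalar multiple of $w_jP_\ell$ for $\ell=1,2$ and all $j\ne \ell$. Put $\mu_1=m\circ(D_1\otimes D_2)$, i.e. $\mu_1(a\otimes b)=D_1(a)D_2(b)$. Let $K_\bullet$ be the quantum Koszul resolution of $S$, $K_m=S^e\otimes\bigwedge^m_{\mathbf q}(V)$, with $$d_m(1\otimes1\otimes w_{j_1}\wedge\dots\wedge w_{j_m})=\sum_{i=1}^m(-1)^{i+1}\Big[\Big(\prod_{s=1}^iq_{j_sj_i}\Big)w_{j_i}\otimes1-\Big(\prod_{s=i}^mq_{j_ij_s}\Big)\otimes w_{j_i}\Big]\otimes w_{j_1}\wedge\dots\widehat{w_{j_i}}\dots\wedge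 w_{j_m}$$ for $j_1<\dots<j_m$. Then $\mathrm{Hom}_{S^e}(K_m,S\#G)=(S\#G)\otimes\bigwedge^m_{\mathbf q^{-1}}(V^*)$, and its second cohomology is $\mathrm{HH}^2(S,S\#G)=\bigoplus_{g\in G}\mathrm{HH}^2(S,S_g)$, where $S_g=\{cg\mid c\in S\}$. The group $G$ acts on it by conjugation on $S\#G$ and by $g(w_i^*)=\chi_i(g)^{-1}w_i^*$ on $V^*$. For a linear map $\gamma:S\otimes S\to S\#G$ let $$R_2(\gamma)=\frac1{|G|}\sum_{g\in G}g(\gamma),\qquad \theta_2^*(\gamma)(ag\otimes bh)=\gamma(a\otimes g(b))\,gh .$$ There exist chain maps $\Psi_\bullet$ (in degrees $\le 3$, with $\Psi_0=\mathrm{id}$) from the bar resolution of $S$ to $K_\bullet$ such that $\Psi_2(1\otimes w_i\otimes w_j\otimes1)$ equals $1\otimes1\otimes w_i\wedge w_j$ for $i<j$ and $0$ for $i\ge j$. For each such $\Psi$, with $\Psi_2^*(\kappa)(a\otimes b)=\kappa(\Psi_2(1\otimes a\otimes b\otimes 1))$, the map $\theta_2^*R_2\Psi_2^*$ induces an isomorphism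 $$\Big(\bigoplus_{g\in G}\mathrm{HH}^2(S,S_g)\Big)^G\longrightarrow\mathrm{HH}^2(S\#G).$$ Moreover $P_1g_1P_2g_2\otimes w_1^*\wedge w_2^*$ is a $2$-cocycle of $\mathrm{Hom}_{S^e}(K_\bullet,S\#G)$ with $G$-invariant class, $\mu_1$ is a Hochschild $2$-cocycle of $S\#G$, and the isomorphism takes the class of $P_1g_1P_2g_2\otimes w_1^*\wedge w_2^*$ to the class of $\mu_1$. -/

import Mathlib

set_option maxSynthPendingDepth 3

namespace QuantumSmash

open scoped TensorProduct
open MulOpposite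

noncomputable section

universe u v

/-! ### Hochschild cohomology in degree two, through the bar complex -/

section Hochschild

variable (𝕜 : Type u) [Field 𝕜] (A : Type v) [Ring A] [Algebra 𝕜 A]

/-- The Hochschild differential from 1-cochains to 2-cochains of `A` with values in `A`:
`(δ h)(a ⊗ b) = a h(b) - h(ab) + h(a) b`. A linear map `A ⊗ A → A` is written in curried form. -/
def hochschildDelta : (A →ₗ[𝕜] A) →ₗ[𝕜] (A →ₗ[𝕜] A →ₗ[𝕜] A) where
  toFun h := LinearMap.mk₂ 𝕜 (fun a b => a * h b - h (a * b) + h a * b)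
    (by intros; simp only [add_mul, map_add]; abel)
    (by intros; simp only [smul_mul_assoc, map_smul, smul_add, smul_sub])
    (by intros; simp only [mul_add, map_add]; abel)
    (by intros; simp only [mul_smul_comm, map_smul, smul_add, smul_sub])
  map_add' h h' := by
    ext a b
    simp only [LinearMap.mk₂_apply, LinearMap.add_apply, mul_add, add_mul]
    abel
  map_smul' c h := by
    ext a b
    simp only [LinearMap.mk₂_apply, LinearMap.smul_apply, mul_smul_comm, smul_mul_assoc,
      smul_add, smul_sub, RingHom.id_apply]

/-- Hochschild 2-cocycles of `A`: bilinear maps `f` with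
`a f(b, c) + f(a, bc) = f(ab, c) + f(a, b) c`. -/
def hochschildCocycles : Submodule 𝕜 (A →ₗ[𝕜] A →ₗ[𝕜] A) where
  carrier := {f | ∀ a b c, a * f b c + f a (b * c) = f (a * b) c + f a b * c}
  zero_mem' := by intro a b c; simp
  add_mem' := by
    intro f f' hf hf' a b c
    have h1 := hf a b c
    have h2 := hf' a b c
    simp only [LinearMap.add_apply, mul_add, add_mul]
    calc _ = (a * f b c + f a (b * c)) + (a * f' b c + f' a (b * c)) := by abel
      _ = _ := by rw [h1, h2]; abel
  smul_mem' := by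
    intro r f hf a b c
    have h1 := hf a b c
    simp only [LinearMap.smul_apply, mul_smul_comm, smul_mul_assoc, ← smul_add, h1]

/-- Hochschild 2-coboundaries of `A`. -/
def hochschildCoboundaries : Submodule 𝕜 (A →ₗ[𝕜] A →ₗ[𝕜] A) :=
  LinearMap.range (hochschildDelta 𝕜 A)

/-- `HH²(A)`, the second Hochschild cohomology of `A` with coefficients in `A`. -/
abbrev HH2 : Type v :=
  hochschildCocycles 𝕜 A ⧸ (hochschildCoboundaries 𝕜 A).submoduleOf (hochschildCocycles 𝕜 A)

variable {𝕜 A} in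
/-- The class of a 2-cocycle in `HH²(A)`. -/
def HH2.mk (f : A →ₗ[𝕜] A →ₗ[𝕜] A) (hf : f ∈ hochschildCocycles 𝕜 A) : HH2 𝕜 A :=
  Submodule.Quotient.mk ⟨f, hf⟩

end Hochschild

/-! ### The quantum symmetric algebra, the diagonal action and the smash product -/

variable {𝕜 : Type u} [Field 𝕜] {G : Type v} [Group G] {k : ℕ}

/-- The relations `w_i w_j = q_ij w_j w_i`. -/
inductive SymRel (q : Fin k → Fin k → 𝕜ˣ) :
    FreeAlgebra 𝕜 (Fin k) → FreeAlgebra 𝕜 (Fin k) → Prop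
  | swap (i j : Fin k) : SymRel q (FreeAlgebra.ι 𝕜 i * FreeAlgebra.ι 𝕜 j)
      ((q i j : 𝕜) • (FreeAlgebra.ι 𝕜 j * FreeAlgebra.ι 𝕜 i))

/-- The quantum symmetric algebra `S_q(V)` of the vector space `V` with basis `w_1, …, w_k`
(indexed by `Fin k`, hence from `0`): the tensor algebra of `V`, i.e. the free algebra on the
basis, modulo `w_i w_j - q_ij w_j w_i`. The algebra does not depend on the characters `χ`; they
are recorded in the type because they determine the action `g(w_i) = χ_i(g) w_i` of `G` that is
put on it below. -/
def QSym (q : Fin k → Fin k → 𝕜ˣ) (_χ : Fin k → G →* 𝕜ˣ) : Type u := RingQuot (SymRel q)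

section Algebras

variable (q : Fin k → Fin k → 𝕜ˣ) (χ : Fin k → G →* 𝕜ˣ)

instance : Ring (QSym q χ) := inferInstanceAs (Ring (RingQuot (SymRel q)))

instance : Algebra 𝕜 (QSym q χ) := inferInstanceAs (Algebra 𝕜 (RingQuot (SymRel q)))

/-- The generator `w_i` of `S_q(V)`. -/
def gen (i : Fin k) : QSym q χ := RingQuot.mkAlgHom 𝕜 (SymRel q) (FreeAlgebra.ι 𝕜 i)

theorem gen_mul_gen (i j : Fin k) :
    gen q χ i * gen q χ j = (q i j : 𝕜) • (gen q χ j * gen q χ i) := by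
  have h := RingQuot.mkAlgHom_rel 𝕜 (SymRel.swap (q := q) i j)
  rw [map_mul, map_smul, map_mul] at h
  exact h

variable {q χ} in
/-- Algebra maps out of `S_q(V)` that agree on the generators are equal. -/
theorem QSym.hom_ext {B : Type*} [Semiring B] [Algebra 𝕜 B] {f f' : QSym q χ →ₐ[𝕜] B}
    (h : ∀ i, f (gen q χ i) = f' (gen q χ i)) : f = f' := by
  refine RingQuot.ringQuot_ext' 𝕜 f f' ?_
  refine FreeAlgebra.hom_ext ?_
  funext i
  exact h i

/-- The algebra endomorphism `w_i ↦ χ_i(g) w_i` of `S_q(V)`. -/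
def actHom (g : G) : QSym q χ →ₐ[𝕜] QSym q χ :=
  RingQuot.liftAlgHom 𝕜 (s := SymRel q)
    ⟨FreeAlgebra.lift 𝕜 (fun i => (χ i g : 𝕜) • gen q χ i), by
      intro x y h
      induction h with
      | swap i j =>
        simp only [map_mul, map_smul, FreeAlgebra.lift_ι_apply, smul_mul_assoc, mul_smul_comm]
        rw [gen_mul_gen q χ i j, smul_comm (χ i g : 𝕜) (χ j g : 𝕜),
          smul_comm (χ i g : 𝕜) (q i j : 𝕜), smul_comm (χ j g : 𝕜) (q i j : 𝕜)]⟩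

theorem actHom_gen (g : G) (i : Fin k) :
    actHom q χ g (gen q χ i) = (χ i g : 𝕜) • gen q χ i := by
  unfold actHom gen
  refine (RingQuot.liftAlgHom_mkAlgHom_apply _ _ _ _).trans ?_
  simp

/-- The action of `G` on `S_q(V)` by algebra automorphisms with `g(w_i) = χ_i(g) w_i`. -/
instance : MulSemiringAction G (QSym q χ) where
  smul g a := actHom q χ g a
  one_smul a := by
    have h : actHom q χ 1 = AlgHom.id 𝕜 (QSym q χ) := QSym.hom_ext (fun i => by simp [actHom_gen])
    exact congrArg (fun f : QSym q χ →ₐ[𝕜] QSym q χ => f a) h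
  mul_smul g g' a := by
    have h : actHom q χ (g * g') = (actHom q χ g).comp (actHom q χ g') :=
      QSym.hom_ext (fun i => by
        simp only [actHom_gen, map_mul, Units.val_mul, AlgHom.comp_apply, map_smul, smul_smul,
          mul_comm])
    exact congrArg (fun f : QSym q χ →ₐ[𝕜] QSym q χ => f a) h
  smul_zero g := map_zero (actHom q χ g)
  smul_add g := map_add (actHom q χ g)
  smul_one g := map_one (actHom q χ g)
  smul_mul g := map_mul (actHom q χ g)

theorem smul_eq_actHom (g : G) (a : QSym q χ) : g • a = actHom q χ g a := rfl

instance : SMulCommClass G 𝕜 (QSym q χ) where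
  smul_comm g c a := map_smul (actHom q χ g) c a

/-- The smash product `S_q(V) # G`: finite sums of elements `a # g`, with
`(a # g)(b # h) = a g(b) # gh`. Here `a # g` is `SkewMonoidAlgebra.single g a`. -/
abbrev Smash : Type (max u v) := SkewMonoidAlgebra (QSym q χ) G

/-- The inclusion `a ↦ a # 1` of `S_q(V)` in `S_q(V) # G`. -/
def incl : QSym q χ →ₗ[𝕜] Smash q χ where
  toFun a := SkewMonoidAlgebra.single 1 a
  map_add' a b := SkewMonoidAlgebra.single_add 1 a b
  map_smul' c a := (SkewMonoidAlgebra.smul_single c 1 a).symm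

/-- The element `g = 1 # g` of `S_q(V) # G`. -/
def grp (g : G) : Smash q χ := SkewMonoidAlgebra.single g 1

theorem incl_mul (a b : QSym q χ) : incl q χ (a * b) = incl q χ a * incl q χ b := by
  simp [incl, SkewMonoidAlgebra.single_mul_single]

theorem grp_mul_incl (g : G) (a : QSym q χ) :
    grp q χ g * incl q χ a = incl q χ (g • a) * grp q χ g := by
  simp [grp, incl, SkewMonoidAlgebra.single_mul_single]

theorem grp_mul_grp (g h : G) : grp q χ g * grp q χ h = grp q χ (g * h) := by
  simp [grp, SkewMonoidAlgebra.single_mul_single]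

theorem grp_one : grp q χ 1 = 1 := rfl

/-- The action of `g ∈ G` on `S_q(V) # G` by conjugation, `g(a # h) = g(a) # g h g⁻¹`. -/
def conj (g : G) : Smash q χ →ₗ[𝕜] Smash q χ where
  toFun x := grp q χ g * x * grp q χ g⁻¹
  map_add' x y := by simp only [mul_add, add_mul]
  map_smul' c x := by simp only [mul_smul_comm, smul_mul_assoc, RingHom.id_apply]

/-! ### Structures of `H_q`-module algebra -/

/-- `σ, D₁, D₂` make the algebra `A` an `H_t`-module algebra, where `H_t` is the Hopf algebra
generated by `D₁, D₂, σ, σ⁻¹` with relations `D₁ D₂ = D₂ D₁`, `t σ D_l = D_l σ` and, if `t` is a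
primitive `n`-th root of unity for some `n ≥ 2`, also `D₁ ^ n = D₂ ^ n = 0`, and with
`Δ σ = σ ⊗ σ`, `Δ D₁ = D₁ ⊗ σ + 1 ⊗ D₁`, `Δ D₂ = D₂ ⊗ 1 + σ ⊗ D₂`, `ε σ = 1`, `ε D_l = 0`.
The first four fields say that the relations act by zero, so that `A` is an `H_t`-module; the
others are `h(ab) = ∑ h₁(a) h₂(b)` and `h(1) = ε(h) 1` for the generators `h`. -/
structure IsHopfModuleAlgebra {A : Type*} [Ring A] [Algebra 𝕜 A] (t : 𝕜ˣ)
    (σ D₁ D₂ : A →ₗ[𝕜] A) : Prop where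
  bijective : Function.Bijective σ
  comm : ∀ a, D₁ (D₂ a) = D₂ (D₁ a)
  qcomm : ∀ a, (t : 𝕜) • σ (D₁ a) = D₁ (σ a) ∧ (t : 𝕜) • σ (D₂ a) = D₂ (σ a)
  nilpotent : ∀ n : ℕ, 2 ≤ n → IsPrimitiveRoot (t : 𝕜) n → D₁ ^ n = 0 ∧ D₂ ^ n = 0
  σ_mul : ∀ a b, σ (a * b) = σ a * σ b
  D₁_mul : ∀ a b, D₁ (a * b) = D₁ a * σ b + a * D₁ b
  D₂_mul : ∀ a b, D₂ (a * b) = D₂ a * b + σ a * D₂ b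
  σ_one : σ 1 = 1
  D_one : D₁ 1 = 0 ∧ D₂ 1 = 0

/-- The bilinear map `m ∘ (D₁ ⊗ D₂)`, that is `(a, b) ↦ D₁(a) D₂(b)`. -/
def infinitesimal {A : Type*} [Ring A] [Algebra 𝕜 A] (D₁ D₂ : A →ₗ[𝕜] A) :
    A →ₗ[𝕜] A →ₗ[𝕜] A :=
  (LinearMap.mul 𝕜 A).compl₁₂ D₁ D₂

/-! ### The quantum Koszul complex -/

/-- The enveloping algebra `S_q(V) ⊗ S_q(V)ᵒᵖ`. A bimodule over `S_q(V)` is a left module over it,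
`a ⊗ b` acting by `x ↦ a x b`. -/
abbrev Env : Type u := QSym q χ ⊗[𝕜] (QSym q χ)ᵐᵒᵖ

/-- The `m`-element subsets `{j_1 < … < j_m}` of the index set; they index the basis
`w_{j_1} ∧ … ∧ w_{j_m}` of the degree `m` part of the quantum exterior algebra of `V`. -/
abbrev Subs (k m : ℕ) : Type := {β : Finset (Fin k) // β.card = m}

/-- The subset `β` without its element `i`. -/
def Subs.remove {m : ℕ} (β : Subs k (m + 1)) (i : {i // i ∈ β.1}) : Subs k m :=
  ⟨β.1.erase i.1, by rw [Finset.card_erase_of_mem i.2, β.2]; rfl⟩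

/-- The degree `m` term `S_q(V)ᵉ ⊗ ⋀^m_q(V)` of the quantum Koszul resolution, the free module over
the enveloping algebra on the elements `w_{j_1} ∧ … ∧ w_{j_m}` with `j_1 < … < j_m`. -/
abbrev Koszul (m : ℕ) : Type u := Subs k m →₀ Env q χ

/-- The basis element `1 ⊗ 1 ⊗ w_{j_1} ∧ … ∧ w_{j_m}`. -/
def wedge {m : ℕ} (β : Subs k m) : Koszul q χ m := Finsupp.single β 1

/-- The differential of the quantum Koszul resolution. It is linear over the enveloping algebra and
maps `1 ⊗ 1 ⊗ w_{j_1} ∧ … ∧ w_{j_m}` to the sum over `i` of `(-1) ^ (i + 1)` times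
`[(∏_{s ≤ i} q_{j_s j_i}) w_{j_i} ⊗ 1 - (∏_{s ≥ i} q_{j_i j_s}) 1 ⊗ w_{j_i}]`
times the wedge product with `w_{j_i}` left out. The exponent below is `i - 1`, the number of
elements before `j_i`. -/
def koszulD (m : ℕ) : Koszul q χ (m + 1) →ₗ[Env q χ] Koszul q χ m :=
  Finsupp.linearCombination (Env q χ) (fun β : Subs k (m + 1) =>
    ∑ i : {i // i ∈ β.1}, Finsupp.single (β.remove i)
      ((-1 : 𝕜) ^ (β.1.filter (fun s => s < i.1)).card •
        ((∏ s ∈ β.1.filter (fun s => s ≤ i.1), (q s i.1 : 𝕜)) • (gen q χ i.1 ⊗ₜ[𝕜] 1)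
          - (∏ s ∈ β.1.filter (fun s => i.1 ≤ s), (q i.1 s : 𝕜)) •
            (1 ⊗ₜ[𝕜] op (gen q χ i.1)) : Env q χ)))

/-! ### Cochains on the Koszul complex and their cohomology -/

/-- `Hom(K_m, S_q(V) # G)`, the bimodule maps from the `m`-th term of the Koszul resolution, which
is `(S_q(V) # G) ⊗ ⋀^m(V*)`: the function `κ` is the bimodule map with
`1 ⊗ 1 ⊗ w_{j_1} ∧ … ∧ w_{j_m} ↦ κ {j_1, …, j_m}`, i.e. the sum over `β` of
`κ β ⊗ (w*)^{∧ β}`. -/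
abbrev KCochain (m : ℕ) : Type (max u v) := Subs k m → Smash q χ

/-- `x ↦ (a ⊗ b ↦ a x b)`. -/
def sandwich : Smash q χ →ₗ[𝕜] Env q χ →ₗ[𝕜] Smash q χ where
  toFun x := TensorProduct.lift (LinearMap.mk₂ 𝕜
    (fun a b => incl q χ a * x * incl q χ (unop b))
    (by intros; simp only [map_add, add_mul])
    (by intros; simp only [map_smul, smul_mul_assoc])
    (by intros; simp only [unop_add, map_add, mul_add])
    (by intros; simp only [unop_smul, map_smul, mul_smul_comm]))
  map_add' x y := by
    apply TensorProduct.ext'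
    intro a b
    simp [mul_add, add_mul]
  map_smul' c x := by
    apply TensorProduct.ext'
    intro a b
    simp

/-- The bimodule map `K_m → S_q(V) # G` given by a cochain: `a ⊗ b ⊗ w^{∧ β} ↦ a κ(β) b`. -/
def koszulEval (m : ℕ) : KCochain q χ m →ₗ[𝕜] Koszul q χ m →ₗ[𝕜] Smash q χ where
  toFun κ := Finsupp.lsum 𝕜 (fun β => sandwich q χ (κ β))
  map_add' κ κ' := by
    apply Finsupp.lhom_ext
    intro β e
    simp
  map_smul' c κ := by
    apply Finsupp.lhom_ext
    intro β e
    simp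

/-- The differential of the complex `Hom(K_•, S_q(V) # G)`: composition with `koszulD`. -/
def koszulDelta (m : ℕ) : KCochain q χ m →ₗ[𝕜] KCochain q χ (m + 1) :=
  LinearMap.pi (fun β =>
    (LinearMap.applyₗ (R := 𝕜) (koszulD q χ m (wedge q χ β))).comp (koszulEval q χ m))

/-- 2-cocycles of `Hom(K_•, S_q(V) # G)`. -/
def koszulCocycles : Submodule 𝕜 (KCochain q χ 2) := LinearMap.ker (koszulDelta q χ 2)

/-- 2-coboundaries of `Hom(K_•, S_q(V) # G)`. -/
def koszulCoboundaries : Submodule 𝕜 (KCochain q χ 2) := LinearMap.range (koszulDelta q χ 1)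

/-- `HH²(S_q(V), S_q(V) # G)`, computed by the quantum Koszul resolution. As
`S_q(V) # G` is the direct sum of its sub-bimodules `(S_q(V))_g = {c g}`, this is
`⊕_g HH²(S_q(V), (S_q(V))_g)`. -/
abbrev KoszulHH2 : Type (max u v) :=
  koszulCocycles q χ ⧸ (koszulCoboundaries q χ).submoduleOf (koszulCocycles q χ)

variable {q χ} in
/-- The class of a 2-cocycle in `HH²(S_q(V), S_q(V) # G)`. -/
def KoszulHH2.mk (κ : KCochain q χ 2) (hκ : κ ∈ koszulCocycles q χ) : KoszulHH2 q χ :=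
  Submodule.Quotient.mk ⟨κ, hκ⟩

/-- The action of `g ∈ G` on `(S_q(V) # G) ⊗ ⋀^m(V*)`: conjugation on `S_q(V) # G`, and
`g(w_i*) = χ_i(g)⁻¹ w_i*`. -/
def koszulAct (m : ℕ) (g : G) : KCochain q χ m →ₗ[𝕜] KCochain q χ m :=
  LinearMap.pi (fun β =>
    (∏ i ∈ β.1, ((χ i g : 𝕜)⁻¹)) • (conj q χ g).comp (LinearMap.proj β))

theorem koszulDelta_apply (m : ℕ) (κ : KCochain q χ m) (β : Subs k (m + 1)) :
    koszulDelta q χ m κ β = ∑ i : {i // i ∈ β.1},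
      (-1 : 𝕜) ^ (β.1.filter (fun s => s < i.1)).card •
        ((∏ s ∈ β.1.filter (fun s => s ≤ i.1), (q s i.1 : 𝕜)) •
            (incl q χ (gen q χ i.1) * κ (β.remove i))
          - (∏ s ∈ β.1.filter (fun s => i.1 ≤ s), (q i.1 s : 𝕜)) •
            (κ (β.remove i) * incl q χ (gen q χ i.1))) := by
  have h1 : incl q χ 1 = 1 := rfl
  simp [koszulDelta, koszulEval, koszulD, wedge, sandwich, h1]

theorem koszulAct_apply (m : ℕ) (g : G) (κ : KCochain q χ m) (β : Subs k m) :
    koszulAct q χ m g κ β = (∏ i ∈ β.1, ((χ i g : 𝕜)⁻¹)) • conj q χ g (κ β) := rfl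

theorem gen_mul_conj (g : G) (i : Fin k) (x : Smash q χ) :
    conj q χ g (incl q χ (gen q χ i) * x) =
      (χ i g : 𝕜) • (incl q χ (gen q χ i) * conj q χ g x) := by
  change grp q χ g * (incl q χ (gen q χ i) * x) * grp q χ g⁻¹ =
    (χ i g : 𝕜) • (incl q χ (gen q χ i) * (grp q χ g * x * grp q χ g⁻¹))
  rw [← mul_assoc (grp q χ g), grp_mul_incl, smul_eq_actHom, actHom_gen, map_smul]
  simp only [smul_mul_assoc, mul_assoc]

theorem conj_mul_gen (g : G) (i : Fin k) (x : Smash q χ) :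
    conj q χ g (x * incl q χ (gen q χ i)) =
      (χ i g : 𝕜) • (conj q χ g x * incl q χ (gen q χ i)) := by
  change grp q χ g * (x * incl q χ (gen q χ i)) * grp q χ g⁻¹ =
    (χ i g : 𝕜) • (grp q χ g * x * grp q χ g⁻¹ * incl q χ (gen q χ i))
  rw [mul_assoc _ (grp q χ g⁻¹), grp_mul_incl, smul_eq_actHom, actHom_gen, map_smul]
  simp only [smul_mul_assoc, mul_smul_comm, mul_assoc, map_inv, smul_smul, Units.mul_inv, one_smul]

theorem koszulDelta_act (m : ℕ) (g : G) (κ : KCochain q χ m) :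
    koszulDelta q χ m (koszulAct q χ m g κ) = koszulAct q χ (m + 1) g (koszulDelta q χ m κ) := by
  funext β
  rw [koszulAct_apply, koszulDelta_apply, koszulDelta_apply, map_sum, Finset.smul_sum]
  refine Finset.sum_congr rfl (fun i _ => ?_)
  rw [koszulAct_apply, map_smul, map_sub, map_smul, map_smul, gen_mul_conj, conj_mul_gen]
  have hβ : (∏ s ∈ β.1, ((χ s g : 𝕜)⁻¹)) * (χ i.1 g : 𝕜) =
      ∏ s ∈ (β.remove i).1, ((χ s g : 𝕜)⁻¹) := by
    rw [← Finset.mul_prod_erase β.1 _ i.2, mul_comm, ← mul_assoc,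
      mul_inv_cancel₀ (Units.ne_zero _), one_mul]
    rfl
  rw [← hβ]
  simp only [smul_sub, smul_smul, mul_smul_comm, smul_mul_assoc]
  congr 2 <;> ring

/-- The action of `g ∈ G` on `HH²(S_q(V), S_q(V) # G)`. -/
def koszulHH2Act (g : G) : KoszulHH2 q χ →ₗ[𝕜] KoszulHH2 q χ :=
  Submodule.mapQ _ _
    ((koszulAct q χ 2 g).restrict (p := koszulCocycles q χ) (q := koszulCocycles q χ) (by
      intro κ hκ
      have h : koszulDelta q χ 2 κ = 0 := hκ
      change koszulDelta q χ 2 (koszulAct q χ 2 g κ) = 0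
      rw [koszulDelta_act, h, map_zero]))
    (by
      rintro ⟨κ, hκ⟩ ⟨f, hf⟩
      exact ⟨koszulAct q χ 1 g f, (koszulDelta_act q χ 1 g f).trans
        (congrArg (koszulAct q χ 2 g) hf)⟩)

/-- The `G`-invariants of `HH²(S_q(V), S_q(V) # G)`. -/
def invariants : Submodule 𝕜 (KoszulHH2 q χ) where
  carrier := {x | ∀ g : G, koszulHH2Act q χ g x = x}
  zero_mem' g := map_zero _
  add_mem' hx hy g := by rw [map_add, hx g, hy g]
  smul_mem' c x hx g := by rw [map_smul, hx g]

/-! ### The maps `Ψ`, `R₂` and `θ₂*` -/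

/-- The part in degrees at most three of a chain map `Ψ` over the identity of `S_q(V)` from the bar
resolution to the quantum Koszul resolution, with `Ψ₀` the identity of `S_q(V)ᵉ`. A bimodule map
on `S_q(V)^{⊗ (n + 2)}` is given by its values on `1 ⊗ a_1 ⊗ … ⊗ a_n ⊗ 1`, and the fields
`toFun1`, `toFun2`, `toFun3` are these values as functions of the `a_i`; the other fields say that
`d_n Ψ_n` and `Ψ_{n-1} δ_n` agree on `1 ⊗ a_1 ⊗ … ⊗ a_n ⊗ 1` for `n = 1, 2, 3`. -/
structure BarToKoszul where
  toFun1 : QSym q χ →ₗ[𝕜] Koszul q χ 1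
  toFun2 : QSym q χ →ₗ[𝕜] QSym q χ →ₗ[𝕜] Koszul q χ 2
  toFun3 : QSym q χ →ₗ[𝕜] QSym q χ →ₗ[𝕜] QSym q χ →ₗ[𝕜] Koszul q χ 3
  comm1 : ∀ a, koszulD q χ 0 (toFun1 a) =
    (a ⊗ₜ[𝕜] 1 - 1 ⊗ₜ[𝕜] op a : Env q χ) • wedge q χ ⟨∅, Finset.card_empty⟩
  comm2 : ∀ a b, koszulD q χ 1 (toFun2 a b) =
    (a ⊗ₜ[𝕜] 1 : Env q χ) • toFun1 b - toFun1 (a * b) + (1 ⊗ₜ[𝕜] op b : Env q χ) • toFun1 a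
  comm3 : ∀ a b c, koszulD q χ 2 (toFun3 a b c) =
    (a ⊗ₜ[𝕜] 1 : Env q χ) • toFun2 b c - toFun2 (a * b) c + toFun2 a (b * c)
      - (1 ⊗ₜ[𝕜] op c : Env q χ) • toFun2 a b

variable {q χ} in
/-- The normalization of `Ψ₂` on generators: `Ψ₂(1 ⊗ w_i ⊗ w_j ⊗ 1)` is
`1 ⊗ 1 ⊗ w_i ∧ w_j` for `i < j`, and `0` for `i ≥ j`. -/
structure BarToKoszul.IsNormalized (Ψ : BarToKoszul q χ) : Prop where
  of_lt : ∀ (i j : Fin k) (h : i < j), Ψ.toFun2 (gen q χ i) (gen q χ j) =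
    wedge q χ ⟨{i, j}, Finset.card_pair h.ne⟩
  of_ge : ∀ i j : Fin k, j ≤ i → Ψ.toFun2 (gen q χ i) (gen q χ j) = 0

variable {q χ} in
/-- `Ψ₂*`: the map `a ⊗ b ↦ κ(Ψ₂(1 ⊗ a ⊗ b ⊗ 1))`. -/
def BarToKoszul.pullback (Ψ : BarToKoszul q χ) (κ : KCochain q χ 2) :
    QSym q χ →ₗ[𝕜] QSym q χ →ₗ[𝕜] Smash q χ :=
  Ψ.toFun2.compr₂ (koszulEval q χ 2 κ)

/-- The action of `g` on `S_q(V)` as a linear map. -/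
def smulLin (g : G) : QSym q χ →ₗ[𝕜] QSym q χ := (actHom q χ g).toLinearMap

/-- `R₂(γ) = |G|⁻¹ ∑_g g(γ)`, where `g(γ)(a ⊗ b) = g(γ(g⁻¹(a) ⊗ g⁻¹(b)))`. -/
def reynolds [Fintype G] (γ : QSym q χ →ₗ[𝕜] QSym q χ →ₗ[𝕜] Smash q χ) :
    QSym q χ →ₗ[𝕜] QSym q χ →ₗ[𝕜] Smash q χ :=
  ((Fintype.card G : 𝕜)⁻¹) • ∑ g : G,
    (γ.compl₁₂ (smulLin q χ g⁻¹) (smulLin q χ g⁻¹)).compr₂ (conj q χ g)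

/-- The coefficient `a_g` of `x = ∑ a_g # g`, as a linear function of `x`. -/
def coeffLin (g : G) : Smash q χ →ₗ[𝕜] QSym q χ where
  toFun x := x.coeff g
  map_add' x y := by rw [SkewMonoidAlgebra.coeff_add, Finsupp.add_apply]
  map_smul' c x := by rw [SkewMonoidAlgebra.coeff_smul, Finsupp.smul_apply, RingHom.id_apply]

/-- Right multiplication by an element of `S_q(V) # G`. -/
def mulRightLin (y : Smash q χ) : Smash q χ →ₗ[𝕜] Smash q χ := LinearMap.mulRight 𝕜 y

/-- `θ₂*`, the bilinear extension of `θ₂*(γ)(a g ⊗ b h) = γ(a ⊗ g(b)) g h`. -/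
def theta [Fintype G] (γ : QSym q χ →ₗ[𝕜] QSym q χ →ₗ[𝕜] Smash q χ) :
    Smash q χ →ₗ[𝕜] Smash q χ →ₗ[𝕜] Smash q χ :=
  ∑ g : G, ∑ h : G,
    (γ.compl₁₂ (coeffLin q χ g) (smulLin q χ g ∘ₗ coeffLin q χ h)).compr₂
      (mulRightLin q χ (grp q χ (g * h)))

theorem theta_single [Fintype G] (γ : QSym q χ →ₗ[𝕜] QSym q χ →ₗ[𝕜] Smash q χ)
    (a b : QSym q χ) (g h : G) :
    theta q χ γ (SkewMonoidAlgebra.single g a) (SkewMonoidAlgebra.single h b) =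
      γ a (g • b) * grp q χ (g * h) := by
  classical
  have hc : ∀ (x y : G) (c : QSym q χ),
      coeffLin q χ x (SkewMonoidAlgebra.single y c) = if y = x then c else 0 := fun x y c => by
    simp [coeffLin, Finsupp.single_apply]
  unfold theta
  simp only [LinearMap.sum_apply, LinearMap.compr₂_apply, LinearMap.compl₁₂_apply,
    LinearMap.comp_apply, hc]
  rw [Finset.sum_eq_single g, Finset.sum_eq_single h]
  · simp [mulRightLin, smulLin, smul_eq_actHom]
  · intro y _ hy
    simp [hy.symm]
  · simp
  · intro x _ hx
    simp [hx.symm]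
  · simp

variable {q χ} in
/-- The composition `θ₂* R₂ Ψ₂*` on cochains. -/
def BarToKoszul.transfer [Fintype G] (Ψ : BarToKoszul q χ) (κ : KCochain q χ 2) :
    Smash q χ →ₗ[𝕜] Smash q χ →ₗ[𝕜] Smash q χ :=
  theta q χ (reynolds q χ (Ψ.pullback κ))

/-- The element `x ⊗ w_i* ∧ w_j*` of `(S_q(V) # G) ⊗ ⋀²(V*)`, for `i < j`. -/
def wedgeDual (x : Smash q χ) (i j : Fin k) (h : i < j) : KCochain q χ 2 :=
  Pi.single ⟨{i, j}, Finset.card_pair h.ne⟩ x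

end Algebras

end

end QuantumSmash

open QuantumSmash

/-! Degree two is compared by hand. A Hochschild 2-cocycle `γ` of `S = S_q(V)` has a Koszul part
`w_i ∧ w_j ↦ γ(w_i, w_j) - q_ij γ(w_j, w_i)`. This operation respects cocycles and coboundaries, it
is a left inverse of `Ψ₂*` because of the normalization of `Ψ₂` (`koszulPart_pullback`), and a
cocycle with zero Koszul part is a coboundary (`exists_eq_coboundary`). These facts take the place
of exactness of the Koszul complex.

The constructions rest on one principle, `exists_primitive`: to let `S` act on an extension `B × S`
it is enough to prescribe the generators and check the relations. With coefficients in `Hom(S, B)`,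
where 2-cocycles with values in `B` become derivations, it turns a Koszul cocycle into a Hochschild
cocycle (`exists_cocycle`); the relations are checked on the basis of ordered monomials. Applied to
`K_2` modulo the image of `K_3`, this yields `Ψ₂`, and `Ψ₃` follows by linear algebra.

Since `|G|` is invertible, averaging makes every 2-cocycle `F` of `S # G` cohomologous to one that
vanishes when an argument lies in `G` (`exists_sub_vanishesOnGroup`). Such an `F` equals `θ₂*` of
its restriction to `S`, and that restriction is invariant. So `F` is recovered, up to a coboundary,
from the Koszul part of its restriction (`transfer_koszulPart_sub_mem`), which gives surjectivity;
for injectivity, restrict to `S` and take Koszul parts (`mem_koszulCoboundaries_of_transfer`).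

Finally `μ₁` is a cocycle by the twisted Leibniz rules, it vanishes on `G` because `D₁` and `D₂` do,
and its Koszul part is `P₁ g₁ P₂ g₂ ⊗ w₁* ∧ w₂*`. The claims about this element are therefore
instances of the general statements for `F = μ₁`. -/

namespace QuantumSmash

open scoped TensorProduct
open MulOpposite

universe u v

noncomputable section

variable {𝕜 : Type u} [Field 𝕜] {G : Type v} [Group G] {k : ℕ}

/-! ### The PBW basis of ordered monomials -/

section PBW

variable (q : Fin k → Fin k → 𝕜ˣ) (χ : Fin k → G →* 𝕜ˣ)

/-- The algebra map out of `S_q(V)` given by elements that satisfy its relations. -/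
def QSym.lift {B : Type*} [Semiring B] [Algebra 𝕜 B] (x : Fin k → B)
    (hx : ∀ i j, x i * x j = (q i j : 𝕜) • (x j * x i)) : QSym q χ →ₐ[𝕜] B :=
  RingQuot.liftAlgHom 𝕜 (s := SymRel q)
    ⟨FreeAlgebra.lift 𝕜 x, by
      intro a b h
      induction h with
      | swap i j => simpa using hx i j⟩

theorem QSym.lift_gen {B : Type*} [Semiring B] [Algebra 𝕜 B] (x : Fin k → B)
    (hx : ∀ i j, x i * x j = (q i j : 𝕜) • (x j * x i)) (i : Fin k) :
    QSym.lift q χ x hx (gen q χ i) = x i := by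
  unfold QSym.lift gen
  refine (RingQuot.liftAlgHom_mkAlgHom_apply _ _ _ _).trans ?_
  simp

variable {q χ}

/-- A subspace of `S_q(V)` that contains `1` and is stable under left multiplication by the
generators is everything. -/
theorem QSym.eq_top_of_gen_mul_mem (p : Submodule 𝕜 (QSym q χ)) (h1 : 1 ∈ p)
    (hp : ∀ i, ∀ x ∈ p, gen q χ i * x ∈ p) : p = ⊤ := by
  let π : FreeAlgebra 𝕜 (Fin k) →ₐ[𝕜] QSym q χ := RingQuot.mkAlgHom 𝕜 (SymRel q)
  have key : ∀ a : FreeAlgebra 𝕜 (Fin k), ∀ x ∈ p, π a * x ∈ p := by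
    intro a
    induction a using FreeAlgebra.induction with
    | grade0 r =>
      intro x hx
      rw [AlgHom.commutes, ← Algebra.smul_def]
      exact p.smul_mem r hx
    | grade1 i => exact fun x hx => hp i x hx
    | mul a b ha hb =>
      intro x hx
      rw [map_mul, mul_assoc]
      exact ha _ (hb x hx)
    | add a b ha hb =>
      intro x hx
      rw [map_add, add_mul]
      exact p.add_mem (ha x hx) (hb x hx)
  rw [eq_top_iff]
  intro x _
  obtain ⟨a, ha⟩ : ∃ a, π a = x := RingQuot.mkAlgHom_surjective 𝕜 (SymRel q) x
  have := key a 1 h1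
  rwa [mul_one, ha] at this

variable (q χ)

/-- The product of the generators with indices in a list. -/
def monomial (L : List (Fin k)) : QSym q χ := (L.map (gen q χ)).prod

@[simp] theorem monomial_nil : monomial q χ [] = 1 := rfl

@[simp] theorem monomial_cons (i : Fin k) (L : List (Fin k)) :
    monomial q χ (i :: L) = gen q χ i * monomial q χ L := by simp [monomial]

/-- The span of the monomials of weakly decreasing lists with entries satisfying `p`. -/
def orderedSpan (p : Fin k → Prop) : Submodule 𝕜 (QSym q χ) :=
  Submodule.span 𝕜 {x | ∃ L : List (Fin k), L.Pairwise (· ≥ ·) ∧ (∀ i ∈ L, p i) ∧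
    x = monomial q χ L}

theorem monomial_mem_orderedSpan {p : Fin k → Prop} {L : List (Fin k)} (hL : L.Pairwise (· ≥ ·))
    (hp : ∀ i ∈ L, p i) : monomial q χ L ∈ orderedSpan q χ p :=
  Submodule.subset_span ⟨L, hL, hp, rfl⟩

theorem orderedSpan_mono {p p' : Fin k → Prop} (h : ∀ i, p i → p' i) :
    orderedSpan q χ p ≤ orderedSpan q χ p' :=
  Submodule.span_mono fun _ ⟨L, hL, hp, hx⟩ => ⟨L, hL, fun i hi => h i (hp i hi), hx⟩

theorem gen_mul_mem_of_le {i : Fin k} {x : QSym q χ} (hx : x ∈ orderedSpan q χ (· ≤ i)) :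
    gen q χ i * x ∈ orderedSpan q χ (· ≤ i) := by
  induction hx using Submodule.span_induction with
  | mem x h =>
    obtain ⟨L, hL, hp, rfl⟩ := h
    rw [← monomial_cons]
    refine monomial_mem_orderedSpan q χ (List.pairwise_cons.2 ⟨hp, hL⟩) ?_
    simpa using hp
  | zero => simp
  | add x y _ _ hx hy => rw [mul_add]; exact Submodule.add_mem _ hx hy
  | smul c x _ hx => rw [mul_smul_comm]; exact Submodule.smul_mem _ c hx

/-- Insertion sort: `w_i` is swapped past a larger first letter `w_l` and then inserted into the
tail. The bound `j` varies in the induction, so that it can be `l` for the tail; multiplying by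
`w_l` afterwards keeps the monomials ordered. -/
theorem gen_mul_monomial_mem (L : List (Fin k)) (hL : L.Pairwise (· ≥ ·)) (i j : Fin k)
    (hij : i ≤ j) (hp : ∀ l ∈ L, l ≤ j) :
    gen q χ i * monomial q χ L ∈ orderedSpan q χ (· ≤ j) := by
  induction L generalizing j with
  | nil =>
    rw [← monomial_cons]
    exact monomial_mem_orderedSpan q χ (by simp) (by simpa using hij)
  | cons l L ih =>
    obtain ⟨hl, hL'⟩ := List.pairwise_cons.1 hL
    have hlj : l ≤ j := hp l (by simp)
    rcases le_or_gt l i with hli | hil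
    · rw [← monomial_cons]
      refine monomial_mem_orderedSpan q χ (List.pairwise_cons.2 ⟨?_, hL⟩) ?_
      · simpa [hli] using fun a ha => (hl a ha).trans hli
      · simpa [hij, hlj] using fun a ha => (hl a ha).trans hlj
    · rw [monomial_cons, ← mul_assoc, gen_mul_gen, smul_mul_assoc, mul_assoc]
      refine Submodule.smul_mem _ _ (orderedSpan_mono q χ (fun a ha => le_trans ha hlj) ?_)
      exact gen_mul_mem_of_le q χ (ih hL' l hil.le hl)

theorem gen_mul_mem_orderedSpan {i j : Fin k} (hij : i ≤ j) {x : QSym q χ}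
    (hx : x ∈ orderedSpan q χ (· ≤ j)) : gen q χ i * x ∈ orderedSpan q χ (· ≤ j) := by
  induction hx using Submodule.span_induction with
  | mem x h =>
    obtain ⟨L, hL, hp, rfl⟩ := h
    exact gen_mul_monomial_mem q χ L hL i j hij hp
  | zero => simp
  | add x y _ _ hx hy => rw [mul_add]; exact Submodule.add_mem _ hx hy
  | smul c x _ hx => rw [mul_smul_comm]; exact Submodule.smul_mem _ c hx

/-- The spanning half of the PBW theorem. The bounded versions apply with `j` the largest index. -/
theorem orderedSpan_true : orderedSpan q χ (fun _ => True) = ⊤ := by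
  refine QSym.eq_top_of_gen_mul_mem _
    (monomial_mem_orderedSpan q χ (L := []) (by simp) (by simp)) ?_
  intro i x hx
  have : NeZero k := ⟨fun h => by subst h; exact i.elim0⟩
  obtain ⟨j, hj⟩ : ∃ j : Fin k, ∀ i, i ≤ j := ⟨⊤, fun i => le_top⟩
  refine orderedSpan_mono q χ (p := (· ≤ j)) (fun _ _ => trivial) ?_
  exact gen_mul_mem_orderedSpan q χ (hj i) (orderedSpan_mono q χ (fun a _ => hj a) hx)

/-- The factor by which `w_i` multiplies the ordered monomial with exponents `m` when it is moved
past the larger generators. -/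
def moveFactor (i : Fin k) (m : Multiset (Fin k)) : 𝕜 :=
  (m.map fun j => if i < j then (q i j : 𝕜) else 1).prod

/-- Left multiplication by `w_i` in terms of ordered monomials. -/
def shift (i : Fin k) : Module.End 𝕜 (Multiset (Fin k) →₀ 𝕜) :=
  Finsupp.linearCombination 𝕜 fun m => Finsupp.single (i ::ₘ m) (moveFactor q i m)

theorem shift_single (i : Fin k) (m : Multiset (Fin k)) (c : 𝕜) :
    shift q i (Finsupp.single m c) = Finsupp.single (i ::ₘ m) (c * moveFactor q i m) := by
  simp [shift]

variable {q}

/-- Only the smaller of two generators picks up a factor when moved past the other, so the two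
orders of multiplication differ by exactly `q i j`. Hence `S_q(V)` acts on the free module on
multisets, which gives the independence half of the PBW theorem. -/
theorem shift_mul_shift (hq_diag : ∀ i, q i i = 1) (hq_inv : ∀ i j, q j i = (q i j)⁻¹)
    (i j : Fin k) : shift q i * shift q j = (q i j : 𝕜) • (shift q j * shift q i) := by
  refine Finsupp.lhom_ext fun m c => ?_
  simp only [Module.End.mul_apply, LinearMap.smul_apply, shift_single, Finsupp.smul_single,
    Multiset.cons_swap i j, smul_eq_mul]
  congr 1
  simp only [moveFactor, Multiset.map_cons, Multiset.prod_cons]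
  rcases lt_trichotomy i j with h | rfl | h
  · rw [if_pos h, if_neg h.not_gt]; ring
  · simp [hq_diag]
  · rw [if_pos h, if_neg h.not_gt, hq_inv i j]
    have : (q i j : 𝕜) ≠ 0 := Units.ne_zero _
    simp only [Units.val_inv_eq_inv_val]
    field_simp

variable (hq_diag : ∀ i, q i i = 1) (hq_inv : ∀ i j, q j i = (q i j)⁻¹)

/-- The coordinates of an element of `S_q(V)` with respect to the ordered monomials. -/
def coords : QSym q χ →ₗ[𝕜] (Multiset (Fin k) →₀ 𝕜) :=
  LinearMap.applyₗ (Finsupp.single 0 1) ∘ₗ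
    (QSym.lift q χ (shift q) (shift_mul_shift hq_diag hq_inv)).toLinearMap

/-- In a decreasing list no letter has to pass a larger one, so all move factors are `1`. -/
theorem coords_monomial (L : List (Fin k)) (hL : L.Pairwise (· ≥ ·)) :
    coords χ hq_diag hq_inv (monomial q χ L) = Finsupp.single (L : Multiset (Fin k)) 1 := by
  induction L with
  | nil => simp [coords]
  | cons i L ih =>
    obtain ⟨hi, hL'⟩ := List.pairwise_cons.1 hL
    have h := ih hL'
    simp only [coords, LinearMap.comp_apply, LinearMap.applyₗ_apply_apply,
      AlgHom.toLinearMap_apply] at h ⊢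
    rw [monomial_cons, map_mul, Module.End.mul_apply, h, QSym.lift_gen, shift_single,
      Multiset.cons_coe]
    congr 1
    rw [one_mul, moveFactor]
    refine Multiset.prod_eq_one fun x hx => ?_
    obtain ⟨j, hj, rfl⟩ := Multiset.mem_map.1 hx
    rw [if_neg (not_lt.2 (hi j hj))]

/-- The linear map with prescribed values on the ordered monomials. -/
def onMonomials {M : Type*} [AddCommGroup M] [Module 𝕜 M] (f : List (Fin k) → M) :
    QSym q χ →ₗ[𝕜] M :=
  Finsupp.linearCombination 𝕜 (fun m : Multiset (Fin k) => f (m.sort (· ≥ ·))) ∘ₗ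
    coords χ hq_diag hq_inv

theorem onMonomials_monomial {M : Type*} [AddCommGroup M] [Module 𝕜 M] (f : List (Fin k) → M)
    (L : List (Fin k)) (hL : L.Pairwise (· ≥ ·)) :
    onMonomials χ hq_diag hq_inv f (monomial q χ L) = f L := by
  rw [onMonomials, LinearMap.comp_apply, coords_monomial χ hq_diag hq_inv L hL,
    Finsupp.linearCombination_single, one_smul, Multiset.coe_sort]
  congr 1
  exact List.mergeSort_of_pairwise (by simpa using hL)

end PBW

/-! ### Bimodules and their two-cocycles -/

/-- Commuting left and right actions of the algebra `S` on `B`. The right action is not required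
to be unital. -/
structure BimoduleAction (𝕜 S B : Type*) [Field 𝕜] [Ring S] [Algebra 𝕜 S] [AddCommGroup B]
    [Module 𝕜 B] where
  l : S →ₗ[𝕜] B →ₗ[𝕜] B
  r : S →ₗ[𝕜] B →ₗ[𝕜] B
  one_l : ∀ x, l 1 x = x
  mul_l : ∀ a b x, l (a * b) x = l a (l b x)
  r_mul : ∀ a b x, r (a * b) x = r b (r a x)
  comm : ∀ a b x, l a (r b x) = r b (l a x)

namespace BimoduleAction

section Basic

variable {𝕜 S B : Type*} [Field 𝕜] [Ring S] [Algebra 𝕜 S] [AddCommGroup B] [Module 𝕜 B]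
  (A : BimoduleAction 𝕜 S B)

/-- Hochschild 2-cocycles of `S` with values in a bimodule. -/
def IsCocycle (f : S →ₗ[𝕜] S →ₗ[𝕜] B) : Prop :=
  ∀ a b c, A.l a (f b c) + f a (b * c) = f (a * b) c + A.r c (f a b)

/-- The linear maps from `S` to a bimodule, with the left action on values and the right action
`(φ b)(s) = φ(b s) - φ(b) s`. -/
def hom : BimoduleAction 𝕜 S (S →ₗ[𝕜] B) where
  l := LinearMap.mk₂ 𝕜 (fun a φ => A.l a ∘ₗ φ)
    (by intros; ext; simp) (by intros; ext; simp) (by intros; ext; simp) (by intros; ext; simp)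
  r := LinearMap.mk₂ 𝕜 (fun b φ => φ ∘ₗ LinearMap.mulLeft 𝕜 b - A.r.flip (φ b))
    (by intros; ext; simp [add_mul]; abel) (by intros; ext; simp [smul_sub])
    (by intros; ext; simp; abel) (by intros; ext; simp [smul_sub])
  one_l φ := by ext; simp [A.one_l]
  mul_l a b φ := by ext; simp [A.mul_l]
  r_mul a b φ := by ext; simp [A.r_mul]
  comm a b φ := by ext; simp [A.comm]

theorem hom_l_apply (a : S) (φ : S →ₗ[𝕜] B) (s : S) : A.hom.l a φ s = A.l a (φ s) := rfl

theorem hom_r_apply (b : S) (φ : S →ₗ[𝕜] B) (s : S) :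
    A.hom.r b φ s = φ (b * s) - A.r s (φ b) := rfl

end Basic

section QSym

variable {𝕜 : Type u} [Field 𝕜] {G : Type v} [Group G] {k : ℕ}
  {q : Fin k → Fin k → 𝕜ˣ} {χ : Fin k → G →* 𝕜ˣ}
  {B : Type*} [AddCommGroup B] [Module 𝕜 B] (A : BimoduleAction 𝕜 (QSym q χ) B)

/-- A cocycle whose values on the defining relations of `S_q(V)` are compensated by elements `β i`
is, up to sign, the coboundary of a linear map with values `β i` on the generators. -/
theorem exists_primitive (f : QSym q χ →ₗ[𝕜] QSym q χ →ₗ[𝕜] B) (hf : A.IsCocycle f)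
    (β : Fin k → B)
    (hβ : ∀ i j, f (gen q χ i) (gen q χ j) + A.l (gen q χ i) (β j) + A.r (gen q χ j) (β i) =
      (q i j : 𝕜) • (f (gen q χ j) (gen q χ i) + A.l (gen q χ j) (β i) +
        A.r (gen q χ i) (β j))) :
    ∃ e : QSym q χ →ₗ[𝕜] B, (∀ i, e (gen q χ i) = A.r 1 (β i)) ∧ e 1 = - f 1 1 ∧
      ∀ a b, e (a * b) = A.l a (e b) + A.r b (e a) + A.r 1 (f a b) := by
  -- The action sought on `B × S` is `a (x, s) = (a x + f(a, s) + e(a) s, a s)`; here `a = w_i` and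
  -- `e(w_i) = β i`.
  let W : Fin k → Module.End 𝕜 (B × QSym q χ) := fun i =>
    LinearMap.prod (A.l (gen q χ i) ∘ₗ LinearMap.fst 𝕜 _ _ +
      (f (gen q χ i) + A.r.flip (β i)) ∘ₗ LinearMap.snd 𝕜 _ _)
      (LinearMap.mulLeft 𝕜 (gen q χ i) ∘ₗ LinearMap.snd 𝕜 _ _)
  have hW : ∀ i x s, W i (x, s) =
      (A.l (gen q χ i) x + (f (gen q χ i) s + A.r s (β i)), gen q χ i * s) := fun _ _ _ => rfl
  -- By the cocycle identity, the composite depends on the product `w_i w_j` and on the corrected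
  -- value `f(w_i, w_j) + w_i β_j + β_i w_j`, which is what `hβ` controls.
  have hWW : ∀ i j x s, W i (W j (x, s)) = (A.l (gen q χ i * gen q χ j) x +
      f (gen q χ i * gen q χ j) s + A.r s (f (gen q χ i) (gen q χ j) +
        A.l (gen q χ i) (β j) + A.r (gen q χ j) (β i)), gen q χ i * gen q χ j * s) := by
    intro i j x s
    have h := hf (gen q χ i) (gen q χ j) s
    rw [hW, hW, mul_assoc]
    simp only [map_add, A.mul_l, A.r_mul, A.comm, Prod.mk.injEq, and_true]
    rw [← sub_eq_zero] at h ⊢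
    rw [← h]
    abel
  have hrel : ∀ i j, W i * W j = (q i j : 𝕜) • (W j * W i) := by
    intro i j
    refine LinearMap.ext fun ⟨x, s⟩ => ?_
    rw [Module.End.mul_apply, LinearMap.smul_apply, Module.End.mul_apply, hWW, hWW, hβ i j,
      gen_mul_gen q χ i j]
    simp only [map_smul, LinearMap.smul_apply, Prod.smul_mk, smul_add, smul_mul_assoc, map_add]
  let Λ := QSym.lift q χ W hrel
  have hΛ : ∀ i, Λ (gen q χ i) = W i := fun i => QSym.lift_gen q χ W hrel i
  -- The first component of `a (0, 1)` contains `f(a, 1)` besides the term from `e(a)`.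
  let e : QSym q χ →ₗ[𝕜] B :=
    LinearMap.fst 𝕜 _ _ ∘ₗ LinearMap.applyₗ ((0 : B), (1 : QSym q χ)) ∘ₗ Λ.toLinearMap - f.flip 1
  have he : ∀ a, e a = (Λ a (0, 1)).1 - f a 1 := fun _ => rfl
  have h1 : ∀ s, f 1 s = A.r s (f 1 1) := fun s => by simpa [A.one_l] using hf 1 1 s
  have he1 : e 1 = - f 1 1 := by rw [he, map_one]; simp
  let p : Submodule 𝕜 (QSym q χ) :=
    { carrier := {a | ∀ x s, Λ a (x, s) = (A.l a x + f a s + A.r s (e a), a * s)}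
      zero_mem' := by intro x s; simp [Prod.ext_iff]
      add_mem' := by
        intro a b ha hb x s
        rw [map_add, LinearMap.add_apply, ha, hb]
        simp only [map_add, LinearMap.add_apply, Prod.mk_add_mk, add_mul, Prod.mk.injEq, and_true]
        abel
      smul_mem' := by
        intro c a ha x s
        rw [map_smul, LinearMap.smul_apply, ha]
        simp only [map_smul, LinearMap.smul_apply, Prod.smul_mk, smul_add, smul_mul_assoc] }
  have hp : p = ⊤ := by
    refine QSym.eq_top_of_gen_mul_mem p ?_ ?_
    · intro x s
      rw [map_one, he1, A.one_l, one_mul, h1 s]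
      simp
    · intro i a ha
      have ha' : ∀ x s, Λ (gen q χ i * a) (x, s) = (A.l (gen q χ i * a) x + f (gen q χ i * a) s
          + A.r s (f (gen q χ i) a + A.l (gen q χ i) (e a) + A.r a (β i)),
            gen q χ i * a * s) := by
        intro x s
        rw [map_mul, Module.End.mul_apply, ha x s, hΛ, hW, mul_assoc]
        have h := hf (gen q χ i) a s
        simp only [map_add, A.mul_l, A.r_mul, A.comm, Prod.mk.injEq, and_true]
        rw [← sub_eq_zero] at h ⊢
        rw [← h]
        abel
      intro x s
      -- The right action need not be unital, so `e` is only known after acting by `1`; a further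
      -- right action by `s` absorbs this, as `1 * s = s`.
      rw [ha', he (gen q χ i * a), ha']
      simp only [map_zero, zero_add, add_sub_cancel_left, ← A.r_mul, one_mul]
  have key : ∀ a x s, Λ a (x, s) = (A.l a x + f a s + A.r s (e a), a * s) := fun a => by
    have : a ∈ p := hp ▸ Submodule.mem_top
    exact this
  refine ⟨e, fun i => ?_, he1, fun a b => ?_⟩
  · rw [he, hΛ, hW]
    simp
  · have h := hf a b 1
    have hb : Λ b (0, 1) = (f b 1 + e b, b) := by
      rw [he, add_sub_cancel]
      exact Prod.ext rfl (by rw [key]; simp)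
    rw [he, map_mul, Module.End.mul_apply, hb, key]
    simp only [map_add, mul_one] at h ⊢
    rw [← sub_eq_zero] at h ⊢
    rw [← h]
    abel

/-- Cocycles that agree when the first argument is `1` or a generator are equal. -/
theorem IsCocycle.ext {f f' : QSym q χ →ₗ[𝕜] QSym q χ →ₗ[𝕜] B} (hf : A.IsCocycle f)
    (hf' : A.IsCocycle f') (h1 : f 1 = f' 1) (hg : ∀ i, f (gen q χ i) = f' (gen q χ i)) :
    f = f' := by
  have hp : LinearMap.eqLocus f f' = ⊤ := by
    refine QSym.eq_top_of_gen_mul_mem _ h1 fun i a (ha : f a = f' a) => ?_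
    refine LinearMap.ext fun s => ?_
    have h := hf (gen q χ i) a s
    have h' := hf' (gen q χ i) a s
    rw [hg i, ha, h'] at h
    exact (add_right_cancel h).symm
  exact LinearMap.ext fun a => (hp ▸ Submodule.mem_top : a ∈ LinearMap.eqLocus f f')

/-- A relation of the form `X i j = q_ij X j i` only has to be checked for `i < j`. -/
theorem eq_smul_swap (hq_diag : ∀ i, q i i = 1) (hq_inv : ∀ i j, q j i = (q i j)⁻¹)
    (X : Fin k → Fin k → B) (h : ∀ i j, i < j → X i j = (q i j : 𝕜) • X j i) (i j : Fin k) :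
    X i j = (q i j : 𝕜) • X j i := by
  rcases lt_trichotomy i j with hij | rfl | hij
  · exact h i j hij
  · simp [hq_diag]
  · rw [h j i hij, smul_smul, hq_inv j i]
    simp

/-- The 2-cocycle condition on the Koszul complex, for the values `κ i j` with `i < j`. -/
def IsKoszulCocycle (κ : Fin k → Fin k → B) : Prop :=
  ∀ i j m, i < j → j < m →
    A.l (gen q χ i) (κ j m) - ((q i j : 𝕜) * q i m) • A.r (gen q χ i) (κ j m)
      - (q i j : 𝕜) • A.l (gen q χ j) (κ i m) + (q j m : 𝕜) • A.r (gen q χ j) (κ i m)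
      + ((q i m : 𝕜) * q j m) • A.l (gen q χ m) (κ i j) - A.r (gen q χ m) (κ i j) = 0

/-- The value on `w_i ⊗ w_L` of the cocycle with value `κ i j` on `w_i ⊗ w_j` for `i < j`, where
`L` is a decreasing list: the sum of the errors from moving `w_i` past larger generators. -/
def moveError (κ : Fin k → Fin k → B) (i : Fin k) : List (Fin k) → B
  | [] => 0
  | j :: L => if i < j then A.r (monomial q χ L) (κ i j) +
      (q i j : 𝕜) • A.l (gen q χ j) (moveError κ i L) else 0

variable (hq_diag : ∀ i, q i i = 1) (hq_inv : ∀ i j, q j i = (q i j)⁻¹)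
  (κ : Fin k → Fin k → B)

/-- The linear map `s ↦ f(w_i, s)` for the cocycle described at `moveError`. -/
def moveErrorLin (i : Fin k) : QSym q χ →ₗ[𝕜] B :=
  onMonomials χ hq_diag hq_inv (A.moveError κ i)

theorem moveErrorLin_of_le {i : Fin k} {s : QSym q χ} (hs : s ∈ orderedSpan q χ (· ≤ i)) :
    A.moveErrorLin hq_diag hq_inv κ i s = 0 := by
  have : orderedSpan q χ (· ≤ i) ≤ LinearMap.ker (A.moveErrorLin hq_diag hq_inv κ i) := by
    refine Submodule.span_le.2 ?_
    rintro _ ⟨L, hL, hp, rfl⟩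
    rw [SetLike.mem_coe, LinearMap.mem_ker, moveErrorLin, onMonomials_monomial _ _ _ _ _ hL]
    cases L with
    | nil => rfl
    | cons j L => exact if_neg (not_lt.2 (hp j (by simp)))
  exact this hs

theorem moveErrorLin_gen_mul {i j : Fin k} (hij : i < j) {s : QSym q χ}
    (hs : s ∈ orderedSpan q χ (· ≤ j)) :
    A.moveErrorLin hq_diag hq_inv κ i (gen q χ j * s) = A.r s (κ i j) +
      (q i j : 𝕜) • A.l (gen q χ j) (A.moveErrorLin hq_diag hq_inv κ i s) := by
  have : orderedSpan q χ (· ≤ j) ≤ LinearMap.eqLocus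
      (A.moveErrorLin hq_diag hq_inv κ i ∘ₗ LinearMap.mulLeft 𝕜 (gen q χ j))
      (A.r.flip (κ i j) + (q i j : 𝕜) • (A.l (gen q χ j) ∘ₗ
        A.moveErrorLin hq_diag hq_inv κ i)) := by
    refine Submodule.span_le.2 ?_
    rintro _ ⟨L, hL, hp, rfl⟩
    simp only [SetLike.mem_coe, LinearMap.mem_eqLocus, LinearMap.comp_apply,
      LinearMap.mulLeft_apply, LinearMap.add_apply, LinearMap.smul_apply, LinearMap.flip_apply]
    rw [← monomial_cons, moveErrorLin, onMonomials_monomial _ _ _ _ _ hL,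
      onMonomials_monomial _ _ _ _ _ (List.pairwise_cons.2 ⟨hp, hL⟩)]
    exact if_pos hij
  exact this hs

variable {κ}

/-- This is the compatibility of `w_i ↦ f(w_i, ·)` with the relation between `w_i` and `w_j`. If no
letter of the monomial exceeds `j`, the only error is `κ i j`. Otherwise the first letter `w_m` is
pulled out to the left of `w_i` and `w_j`; what this produces beyond the relation for the tail is
the Koszul cocycle identity for `i < j < m`, multiplied on the right by the tail. -/
theorem moveErrorLin_relation (hκ : A.IsKoszulCocycle κ) {i j : Fin k} (hij : i < j)
    (s : QSym q χ) :
    A.l (gen q χ i) (A.moveErrorLin hq_diag hq_inv κ j s) +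
        A.moveErrorLin hq_diag hq_inv κ i (gen q χ j * s) =
      (q i j : 𝕜) • (A.l (gen q χ j) (A.moveErrorLin hq_diag hq_inv κ i s) +
        A.moveErrorLin hq_diag hq_inv κ j (gen q χ i * s)) + A.r s (κ i j) := by
  set φ := A.moveErrorLin hq_diag hq_inv κ with hφ
  have low : ∀ s ∈ orderedSpan q χ (· ≤ j), A.l (gen q χ i) (φ j s) + φ i (gen q χ j * s) =
      (q i j : 𝕜) • (A.l (gen q χ j) (φ i s) + φ j (gen q χ i * s)) + A.r s (κ i j) := by
    intro s hs
    rw [A.moveErrorLin_of_le hq_diag hq_inv κ hs, A.moveErrorLin_gen_mul hq_diag hq_inv κ hij hs,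
      A.moveErrorLin_of_le hq_diag hq_inv κ (gen_mul_mem_orderedSpan q χ hij.le hs)]
    simp [add_comm, hφ]
  have main : ∀ L : List (Fin k), L.Pairwise (· ≥ ·) →
      A.l (gen q χ i) (φ j (monomial q χ L)) + φ i (gen q χ j * monomial q χ L) =
      (q i j : 𝕜) • (A.l (gen q χ j) (φ i (monomial q χ L)) +
        φ j (gen q χ i * monomial q χ L)) + A.r (monomial q χ L) (κ i j) := by
    intro L
    induction L with
    | nil => exact fun _ => low _ (monomial_mem_orderedSpan q χ (by simp) (by simp))
    | cons m L ih =>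
      intro hL
      obtain ⟨hm, hL'⟩ := List.pairwise_cons.1 hL
      rcases le_or_gt m j with hmj | hjm
      · refine low _ (monomial_mem_orderedSpan q χ hL ?_)
        simpa [hmj] using fun a ha => (hm a ha).trans hmj
      · have hs : monomial q χ L ∈ orderedSpan q χ (· ≤ m) :=
          monomial_mem_orderedSpan q χ hL' hm
        have him := hij.trans hjm
        have hjs := gen_mul_mem_orderedSpan q χ hjm.le hs
        have his := gen_mul_mem_orderedSpan q χ him.le hs
        have e1 := A.moveErrorLin_gen_mul hq_diag hq_inv κ hjm hs
        have e2 := A.moveErrorLin_gen_mul hq_diag hq_inv κ him hs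
        have e3 := A.moveErrorLin_gen_mul hq_diag hq_inv κ him hjs
        have e4 := A.moveErrorLin_gen_mul hq_diag hq_inv κ hjm his
        rw [← hφ] at e1 e2 e3 e4
        have hc := congrArg (A.r (monomial q χ L)) (hκ i j m hij hjm)
        -- The scalar arises from moving `w_m` to the left of `w_i w_j`.
        have hi := congrArg (fun x => ((q i m : 𝕜) * q j m) • A.l (gen q χ m) x) (ih hL')
        rw [monomial_cons, ← mul_assoc, gen_mul_gen q χ j m, smul_mul_assoc, mul_assoc,
          ← mul_assoc (gen q χ i), gen_mul_gen q χ i m, smul_mul_assoc, mul_assoc, map_smul,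
          map_smul, e1, e2, e3, e4]
        simp only [map_add, map_sub, map_smul, map_zero, ← A.mul_l, A.comm, A.r_mul,
          gen_mul_gen q χ i m, gen_mul_gen q χ j m, LinearMap.smul_apply] at hc hi ⊢
        linear_combination (norm := module) hc + hi
  have htop : orderedSpan q χ (fun _ => True) ≤ LinearMap.eqLocus
      (A.l (gen q χ i) ∘ₗ φ j + φ i ∘ₗ LinearMap.mulLeft 𝕜 (gen q χ j))
      ((q i j : 𝕜) • (A.l (gen q χ j) ∘ₗ φ i + φ j ∘ₗ LinearMap.mulLeft 𝕜 (gen q χ i)) +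
        A.r.flip (κ i j)) := by
    refine Submodule.span_le.2 ?_
    rintro _ ⟨L, hL, -, rfl⟩
    exact main L hL
  rw [orderedSpan_true] at htop
  exact htop (Submodule.mem_top (x := s))

/-- Every 2-cocycle on the Koszul complex comes from a Hochschild 2-cocycle. -/
theorem exists_cocycle (hr : ∀ x, A.r 1 x = x) (hκ : A.IsKoszulCocycle κ) :
    ∃ f : QSym q χ →ₗ[𝕜] QSym q χ →ₗ[𝕜] B, A.IsCocycle f ∧ f 1 = 0 ∧
      ∀ i, f (gen q χ i) = A.moveErrorLin hq_diag hq_inv κ i := by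
  set φ := A.moveErrorLin hq_diag hq_inv κ with hφ
  have hone : ∀ i, (1 : QSym q χ) ∈ orderedSpan q χ (· ≤ i) := fun i =>
    monomial_mem_orderedSpan q χ (L := []) (by simp) (by simp)
  have hφ1 : ∀ i, φ i 1 = 0 := fun i => A.moveErrorLin_of_le hq_diag hq_inv κ (hone i)
  -- For the right action on `Hom(S, B)`, the cocycle identity of `f` says that `a ↦ f(a, ·)` is a
  -- derivation, which is a primitive of the zero cocycle.
  obtain ⟨f, hfg, hf1, hf⟩ := A.hom.exists_primitive 0 (fun _ _ _ => by simp) φ (by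
    refine eq_smul_swap hq_diag hq_inv (fun i j => (0 : QSym q χ →ₗ[𝕜] QSym q χ →ₗ[𝕜]
      QSym q χ →ₗ[𝕜] B) (gen q χ i) (gen q χ j) + A.hom.l (gen q χ i) (φ j) +
        A.hom.r (gen q χ j) (φ i)) fun i j hij => ?_
    refine LinearMap.ext fun s => ?_
    have h1 : φ i (gen q χ j) = κ i j := by
      have := A.moveErrorLin_gen_mul hq_diag hq_inv κ hij (hone j)
      rwa [← hφ, mul_one, hφ1, map_zero, smul_zero, add_zero, hr] at this
    have h2 : φ j (gen q χ i) = 0 := by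
      have := A.moveErrorLin_of_le hq_diag hq_inv κ
        (gen_mul_mem_orderedSpan q χ hij.le (hone j))
      rwa [mul_one] at this
    have h3 := A.moveErrorLin_relation hq_diag hq_inv hκ hij s
    rw [← hφ] at h3
    simp only [LinearMap.zero_apply, zero_add, LinearMap.add_apply, LinearMap.smul_apply,
      hom_l_apply, hom_r_apply, h1, h2, map_zero, sub_zero]
    rw [← add_sub_assoc, h3, add_sub_cancel_right])
  refine ⟨f, fun a b c => ?_, by simpa using hf1, fun i => ?_⟩
  · have := LinearMap.congr_fun (hf a b) c
    simp only [LinearMap.add_apply, hom_l_apply, hom_r_apply, LinearMap.zero_apply, map_zero] at this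
    rw [this]
    abel
  -- Acting by `1` on the right subtracts `s ↦ φ_i(1) s`, which is zero.
  · rw [hfg]
    ext s
    simp [hom_r_apply, hφ1]

end QSym

end BimoduleAction

/-! ### The differentials of the quantum Koszul resolution in low degrees -/

section

variable {𝕜 : Type u} [Field 𝕜] {G : Type v} [Group G] {k : ℕ}

/-- The coboundary `(a, b) ↦ a h(b) - h(a b) + h(a) b` of a linear map `h`. -/
def BimoduleAction.coboundary {𝕜 S B : Type*} [Field 𝕜] [Ring S] [Algebra 𝕜 S] [AddCommGroup B]
    [Module 𝕜 B] (A : BimoduleAction 𝕜 S B) (h : S →ₗ[𝕜] B) : S →ₗ[𝕜] S →ₗ[𝕜] B :=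
  LinearMap.mk₂ 𝕜 (fun a b => A.l a (h b) - h (a * b) + A.r b (h a))
    (by intros; simp only [map_add, LinearMap.add_apply, add_mul]; abel)
    (by intros; simp only [map_smul, LinearMap.smul_apply, smul_mul_assoc, smul_add, smul_sub])
    (by intros; simp only [map_add, LinearMap.add_apply, mul_add]; abel)
    (by intros; simp only [map_smul, LinearMap.smul_apply, mul_smul_comm, smul_add, smul_sub])

theorem BimoduleAction.coboundary_apply {𝕜 S B : Type*} [Field 𝕜] [Ring S] [Algebra 𝕜 S]
    [AddCommGroup B] [Module 𝕜 B] (A : BimoduleAction 𝕜 S B) (h : S →ₗ[𝕜] B) (a b : S) :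
    A.coboundary h a b = A.l a (h b) - h (a * b) + A.r b (h a) := rfl

theorem BimoduleAction.isCocycle_coboundary {𝕜 S B : Type*} [Field 𝕜] [Ring S] [Algebra 𝕜 S]
    [AddCommGroup B] [Module 𝕜 B] (A : BimoduleAction 𝕜 S B) (h : S →ₗ[𝕜] B) :
    A.IsCocycle (A.coboundary h) := by
  intro a b c
  simp only [A.coboundary_apply, map_add, map_sub, A.mul_l, A.r_mul, A.comm, mul_assoc]
  abel

theorem sum_subtype_pair {B : Type*} [AddCommMonoid B] {i j : Fin k} (h : i ≠ j)
    (f : {x // x ∈ ({i, j} : Finset (Fin k))} → B) :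
    ∑ x, f x = f ⟨i, by simp⟩ + f ⟨j, by simp⟩ := by
  have hu : (Finset.univ : Finset {x // x ∈ ({i, j} : Finset (Fin k))}) =
      {⟨i, by simp⟩, ⟨j, by simp⟩} := by
    ext ⟨x, hx⟩
    simpa only [Finset.mem_univ, Finset.mem_insert, Finset.mem_singleton, Subtype.mk.injEq,
      true_iff] using hx
  rw [hu, Finset.sum_pair (by simpa using h)]

theorem sum_subtype_triple {B : Type*} [AddCommMonoid B] {i j m : Fin k} (hij : i ≠ j)
    (him : i ≠ m) (hjm : j ≠ m) (f : {x // x ∈ ({i, j, m} : Finset (Fin k))} → B) :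
    ∑ x, f x = f ⟨i, by simp⟩ + (f ⟨j, by simp⟩ + f ⟨m, by simp⟩) := by
  have hu : (Finset.univ : Finset {x // x ∈ ({i, j, m} : Finset (Fin k))}) =
      {⟨i, by simp⟩, ⟨j, by simp⟩, ⟨m, by simp⟩} := by
    ext ⟨x, hx⟩
    simpa only [Finset.mem_univ, Finset.mem_insert, Finset.mem_singleton, Subtype.mk.injEq,
      true_iff] using hx
  rw [hu, Finset.sum_insert (by simpa using ⟨hij, him⟩), Finset.sum_pair (by simpa using hjm)]

theorem Subs.exists_pair (β : Subs k 2) :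
    ∃ (i j : Fin k) (h : i < j), β = ⟨{i, j}, Finset.card_pair h.ne⟩ := by
  obtain ⟨i, j, hij, h⟩ := Finset.card_eq_two.1 β.2
  rcases lt_or_gt_of_ne hij with h' | h'
  · exact ⟨i, j, h', Subtype.ext h⟩
  · exact ⟨j, i, h', Subtype.ext (h.trans (Finset.pair_comm i j))⟩

theorem Subs.exists_triple (β : Subs k 3) : ∃ i j m : Fin k, i < j ∧ j < m ∧ β.1 = {i, j, m} := by
  let e := β.1.orderIsoOfFin β.2
  refine ⟨e 0, e 1, e 2, e.strictMono (by decide), e.strictMono (by decide), ?_⟩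
  ext x
  constructor
  · intro hx
    obtain ⟨y, hy⟩ := e.surjective ⟨x, hx⟩
    have hy' : ((e y : β.1) : Fin k) = x := congrArg Subtype.val hy
    fin_cases y <;> simp_all
  · intro hx
    simp only [Finset.mem_insert, Finset.mem_singleton] at hx
    rcases hx with rfl | rfl | rfl <;> exact Subtype.prop _

theorem Subs.card_triple {i j m : Fin k} (hij : i < j) (hjm : j < m) :
    ({i, j, m} : Finset (Fin k)).card = 3 :=
  Finset.card_eq_three.2 ⟨i, j, m, hij.ne, (hij.trans hjm).ne, hjm.ne, rfl⟩

variable (q : Fin k → Fin k → 𝕜ˣ) (χ : Fin k → G →* 𝕜ˣ)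

/-- A module over the enveloping algebra as a bimodule. -/
def envAction (N : Type*) [AddCommGroup N] [Module 𝕜 N] [Module (Env q χ) N]
    [IsScalarTower 𝕜 (Env q χ) N] : BimoduleAction 𝕜 (QSym q χ) N where
  l := LinearMap.mk₂ 𝕜 (fun a x => (a ⊗ₜ[𝕜] 1 : Env q χ) • x)
    (by intros; rw [TensorProduct.add_tmul, add_smul])
    (by intros; rw [← TensorProduct.smul_tmul', smul_assoc])
    (by intros; rw [smul_add])
    (by intro c a x; rw [← algebraMap_smul (Env q χ) c x, ← algebraMap_smul (Env q χ) c,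
          smul_smul, smul_smul, Algebra.commutes])
  r := LinearMap.mk₂ 𝕜 (fun b x => (1 ⊗ₜ[𝕜] op b : Env q χ) • x)
    (by intros; rw [op_add, TensorProduct.tmul_add, add_smul])
    (by intros; rw [op_smul, TensorProduct.tmul_smul, smul_assoc])
    (by intros; rw [smul_add])
    (by intro c a x; rw [← algebraMap_smul (Env q χ) c x, ← algebraMap_smul (Env q χ) c,
          smul_smul, smul_smul, Algebra.commutes])
  one_l x := one_smul (Env q χ) x
  mul_l a b x := by simp [smul_smul]
  r_mul a b x := by simp [smul_smul]
  comm a b x := by simp [smul_smul]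

theorem envAction_l_apply {N : Type*} [AddCommGroup N] [Module 𝕜 N] [Module (Env q χ) N]
    [IsScalarTower 𝕜 (Env q χ) N] (a : QSym q χ) (x : N) :
    (envAction q χ N).l a x = (a ⊗ₜ[𝕜] 1 : Env q χ) • x := rfl

theorem envAction_r_apply {N : Type*} [AddCommGroup N] [Module 𝕜 N] [Module (Env q χ) N]
    [IsScalarTower 𝕜 (Env q χ) N] (b : QSym q χ) (x : N) :
    (envAction q χ N).r b x = (1 ⊗ₜ[𝕜] op b : Env q χ) • x := rfl

theorem map_envAction_l {N N' : Type*} [AddCommGroup N] [Module 𝕜 N] [Module (Env q χ) N]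
    [IsScalarTower 𝕜 (Env q χ) N] [AddCommGroup N'] [Module 𝕜 N'] [Module (Env q χ) N']
    [IsScalarTower 𝕜 (Env q χ) N'] (f : N →ₗ[Env q χ] N') (a : QSym q χ) (x : N) :
    f ((envAction q χ N).l a x) = (envAction q χ N').l a (f x) := map_smul f _ x

theorem map_envAction_r {N N' : Type*} [AddCommGroup N] [Module 𝕜 N] [Module (Env q χ) N]
    [IsScalarTower 𝕜 (Env q χ) N] [AddCommGroup N'] [Module 𝕜 N'] [Module (Env q χ) N']
    [IsScalarTower 𝕜 (Env q χ) N'] (f : N →ₗ[Env q χ] N') (a : QSym q χ) (x : N) :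
    f ((envAction q χ N).r a x) = (envAction q χ N').r a (f x) := map_smul f _ x

/-- The basis element `1 ⊗ 1 ⊗ w_i` of `K_1`. -/
def wedgeOne (i : Fin k) : Koszul q χ 1 := wedge q χ ⟨{i}, Finset.card_singleton i⟩

/-- The basis element `1 ⊗ 1 ⊗ w_i ∧ w_j` of `K_2` for `i < j`, and `0` for `i ≥ j`. -/
def wedgeTwo (i j : Fin k) : Koszul q χ 2 :=
  if h : i < j then wedge q χ ⟨{i, j}, Finset.card_pair h.ne⟩ else 0

theorem koszulD_wedge (m : ℕ) (β : Subs k (m + 1)) :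
    koszulD q χ m (wedge q χ β) = ∑ i : {i // i ∈ β.1},
      (-1 : 𝕜) ^ (β.1.filter (fun s => s < i.1)).card •
        ((∏ s ∈ β.1.filter (fun s => s ≤ i.1), (q s i.1 : 𝕜)) •
            (envAction q χ (Koszul q χ m)).l (gen q χ i.1) (wedge q χ (β.remove i))
          - (∏ s ∈ β.1.filter (fun s => i.1 ≤ s), (q i.1 s : 𝕜)) •
            (envAction q χ (Koszul q χ m)).r (gen q χ i.1) (wedge q χ (β.remove i))) := by
  rw [koszulD, wedge, Finsupp.linearCombination_single, one_smul]
  refine Finset.sum_congr rfl fun i _ => ?_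
  rw [envAction_l_apply, envAction_r_apply, ← smul_assoc, ← smul_assoc, ← sub_smul, ← smul_assoc,
    wedge, Finsupp.smul_single, smul_eq_mul, mul_one]

variable {q}
theorem koszulD_wedgeOne (hq_diag : ∀ i, q i i = 1) (i : Fin k) : koszulD q χ 0 (wedgeOne q χ i) =
    (envAction q χ (Koszul q χ 0)).l (gen q χ i) (wedge q χ ⟨∅, Finset.card_empty⟩) -
      (envAction q χ (Koszul q χ 0)).r (gen q χ i) (wedge q χ ⟨∅, Finset.card_empty⟩) := by
  rw [wedgeOne, koszulD_wedge]
  have hr : ∀ x : {x // x ∈ ({i} : Finset (Fin k))}, Subs.remove (k := k) (m := 0)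
      ⟨{i}, Finset.card_singleton i⟩ x = ⟨∅, Finset.card_empty⟩ := by
    rintro ⟨x, hx⟩
    obtain rfl := Finset.mem_singleton.1 hx
    exact Subtype.ext (by simp [Subs.remove])
  simp only [hr]
  rw [Fintype.sum_eq_single (⟨i, by simp⟩ : {x // x ∈ ({i} : Finset (Fin k))})
    (by rintro ⟨x, hx⟩ h; exact absurd (Subtype.ext (Finset.mem_singleton.1 hx)) h)]
  simp [Finset.filter_singleton, hq_diag]

theorem koszulD_wedgeTwo (hq_diag : ∀ i, q i i = 1) {i j : Fin k} (hij : i < j) :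
    koszulD q χ 1 (wedgeTwo q χ i j) =
    (envAction q χ (Koszul q χ 1)).l (gen q χ i) (wedgeOne q χ j)
      - (q i j : 𝕜) • (envAction q χ (Koszul q χ 1)).r (gen q χ i) (wedgeOne q χ j)
      - (q i j : 𝕜) • (envAction q χ (Koszul q χ 1)).l (gen q χ j) (wedgeOne q χ i)
      + (envAction q χ (Koszul q χ 1)).r (gen q χ j) (wedgeOne q χ i) := by
  rw [wedgeTwo, dif_pos hij, koszulD_wedge, sum_subtype_pair hij.ne]
  have hri : Subs.remove (k := k) (m := 1) ⟨{i, j}, Finset.card_pair hij.ne⟩ ⟨i, by simp⟩ =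
      ⟨{j}, Finset.card_singleton j⟩ :=
    Subtype.ext (by simp [Subs.remove, Finset.erase_insert_eq_erase, hij.ne])
  have hrj : Subs.remove (k := k) (m := 1) ⟨{i, j}, Finset.card_pair hij.ne⟩ ⟨j, by simp⟩ =
      ⟨{i}, Finset.card_singleton i⟩ := by
    refine Subtype.ext ?_
    ext x
    simp only [Subs.remove, Finset.mem_erase, Finset.mem_insert, Finset.mem_singleton]
    grind
  rw [hri, hrj]
  simp only [Finset.filter_insert, Finset.filter_singleton, lt_irrefl, le_refl, hij, hij.le,
    hij.not_gt, hij.not_ge, if_true, if_false, Finset.card_empty, Finset.card_singleton,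
    Finset.prod_singleton, Finset.prod_pair hij.ne, hq_diag, wedgeOne, insert_empty_eq,
    Units.val_one]
  module

/-- The coefficients are those of `IsKoszulCocycle`, so that condition expresses vanishing on the
boundaries of `K_3`. -/
theorem koszulD_wedge_triple (hq_diag : ∀ i, q i i = 1) {i j m : Fin k}
    (hij : i < j) (hjm : j < m) :
    koszulD q χ 2 (wedge q χ ⟨{i, j, m}, Subs.card_triple hij hjm⟩) =
    (envAction q χ (Koszul q χ 2)).l (gen q χ i) (wedgeTwo q χ j m)
      - ((q i j : 𝕜) * q i m) • (envAction q χ (Koszul q χ 2)).r (gen q χ i) (wedgeTwo q χ j m)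
      - (q i j : 𝕜) • (envAction q χ (Koszul q χ 2)).l (gen q χ j) (wedgeTwo q χ i m)
      + (q j m : 𝕜) • (envAction q χ (Koszul q χ 2)).r (gen q χ j) (wedgeTwo q χ i m)
      + ((q i m : 𝕜) * q j m) • (envAction q χ (Koszul q χ 2)).l (gen q χ m) (wedgeTwo q χ i j)
      - (envAction q χ (Koszul q χ 2)).r (gen q χ m) (wedgeTwo q χ i j) := by
  have him := hij.trans hjm
  rw [koszulD_wedge, sum_subtype_triple hij.ne him.ne hjm.ne]
  have hri : Subs.remove (k := k) (m := 2) ⟨{i, j, m}, Subs.card_triple hij hjm⟩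
      ⟨i, by simp⟩ = ⟨{j, m}, Finset.card_pair hjm.ne⟩ := by
    refine Subtype.ext ?_
    ext x
    simp only [Subs.remove, Finset.mem_erase, Finset.mem_insert, Finset.mem_singleton]
    grind
  have hrj : Subs.remove (k := k) (m := 2) ⟨{i, j, m}, Subs.card_triple hij hjm⟩
      ⟨j, by simp⟩ = ⟨{i, m}, Finset.card_pair him.ne⟩ := by
    refine Subtype.ext ?_
    ext x
    simp only [Subs.remove, Finset.mem_erase, Finset.mem_insert, Finset.mem_singleton]
    grind
  have hrm : Subs.remove (k := k) (m := 2) ⟨{i, j, m}, Subs.card_triple hij hjm⟩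
      ⟨m, by simp⟩ = ⟨{i, j}, Finset.card_pair hij.ne⟩ := by
    refine Subtype.ext ?_
    ext x
    simp only [Subs.remove, Finset.mem_erase, Finset.mem_insert, Finset.mem_singleton]
    grind
  rw [hri, hrj, hrm, wedgeTwo, wedgeTwo, wedgeTwo, dif_pos hij, dif_pos hjm, dif_pos him]
  have p3 : ∀ f : Fin k → 𝕜, ∏ s ∈ ({i, j, m} : Finset (Fin k)), f s = f i * (f j * f m) :=
    fun f => by
      rw [Finset.prod_insert (by simp [hij.ne, him.ne]), Finset.prod_pair hjm.ne]
  simp only [Finset.filter_insert, Finset.filter_singleton, lt_irrefl, le_refl, hij, hij.le,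
    hij.not_gt, hij.not_ge, him, him.le, him.not_gt, him.not_ge, hjm, hjm.le, hjm.not_gt,
    hjm.not_ge, if_true, if_false, Finset.card_empty, Finset.card_singleton,
    Finset.prod_singleton, Finset.prod_pair hij.ne, Finset.prod_pair hjm.ne,
    Finset.card_pair hij.ne, p3, hq_diag, insert_empty_eq, Units.val_one]
  module

theorem koszulD_koszulD (hq_diag : ∀ i, q i i = 1) (x : Koszul q χ 3) :
    koszulD q χ 1 (koszulD q χ 2 x) = 0 := by
  have h : koszulD q χ 1 ∘ₗ koszulD q χ 2 = 0 := by
    refine Finsupp.lhom_ext' fun β => LinearMap.ext_ring ?_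
    obtain ⟨i, j, m, hij, hjm, h⟩ := Subs.exists_triple β
    obtain rfl : β = ⟨{i, j, m}, Subs.card_triple hij hjm⟩ := Subtype.ext h
    change koszulD q χ 1 (koszulD q χ 2 (wedge q χ _)) = 0
    rw [koszulD_wedge_triple χ hq_diag hij hjm]
    set A := envAction q χ (Koszul q χ 1) with hA
    have hs : ∀ (c : 𝕜) (y : Koszul q χ 2), koszulD q χ 1 (c • y) = c • koszulD q χ 1 y :=
      fun c y => by rw [← algebraMap_smul (Env q χ) c y, map_smul, algebraMap_smul]
    -- These rules bring products of two left actions, and of two right actions, into a fixed order,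
    -- after which only scalars have to be compared.
    have r1 := fun x => (A.mul_l (gen q χ i) (gen q χ j) x).symm
    have r2 := fun x => (A.mul_l (gen q χ i) (gen q χ m) x).symm
    have r3 := fun x => (A.mul_l (gen q χ j) (gen q χ m) x).symm
    have r4 := fun x => (A.r_mul (gen q χ i) (gen q χ j) x).symm
    have r5 := fun x => (A.r_mul (gen q χ i) (gen q χ m) x).symm
    have r6 := fun x => (A.r_mul (gen q χ j) (gen q χ m) x).symm
    rw [gen_mul_gen q χ i j] at r1 r4
    rw [gen_mul_gen q χ i m] at r2 r5
    rw [gen_mul_gen q χ j m] at r3 r6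
    simp only [map_smul, LinearMap.smul_apply, A.mul_l, A.r_mul] at r1 r2 r3 r4 r5 r6
    simp only [map_add, map_sub, hs, map_envAction_l, map_envAction_r,
      koszulD_wedgeTwo χ hq_diag hij, koszulD_wedgeTwo χ hq_diag hjm,
      koszulD_wedgeTwo χ hq_diag (hij.trans hjm), map_smul, ← hA, A.comm, r1, r2, r3, r4, r5, r6]
    module
  exact LinearMap.congr_fun h x

end

/-! ### Chain maps from the bar resolution to the quantum Koszul resolution -/

section

variable {𝕜 : Type u} [Field 𝕜] {G : Type v} [Group G] {k : ℕ}
  (q : Fin k → Fin k → 𝕜ˣ) (χ : Fin k → G →* 𝕜ˣ)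

/-- The sum of the elements `w_{j_1} ⋯ w_{j_{s-1}} ⊗ w_{j_{s+1}} ⋯ w_{j_n} ⊗ w_{j_s}` of `K_1` for a
list `j_1, …, j_n`. -/
def listDerivative : List (Fin k) → Koszul q χ 1
  | [] => 0
  | i :: L => (envAction q χ (Koszul q χ 1)).l (gen q χ i) (listDerivative L) +
      (envAction q χ (Koszul q χ 1)).r (monomial q χ L) (wedgeOne q χ i)

variable {q}
variable (hq_diag : ∀ i, q i i = 1) (hq_inv : ∀ i j, q j i = (q i j)⁻¹)

/-- The component `Ψ₁`. -/
def psiOne : QSym q χ →ₗ[𝕜] Koszul q χ 1 := onMonomials χ hq_diag hq_inv (listDerivative q χ)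

theorem psiOne_monomial {L : List (Fin k)} (hL : L.Pairwise (· ≥ ·)) :
    psiOne χ hq_diag hq_inv (monomial q χ L) = listDerivative q χ L :=
  onMonomials_monomial _ _ _ _ _ hL

/-- The sum telescopes: each letter contributes the difference between having it on the left and on
the right of the tensor sign. No ordering of the list is needed. -/
theorem koszulD_listDerivative (hq_diag : ∀ i, q i i = 1) (L : List (Fin k)) :
    koszulD q χ 0 (listDerivative q χ L) =
      (envAction q χ (Koszul q χ 0)).l (monomial q χ L) (wedge q χ ⟨∅, Finset.card_empty⟩) -
      (envAction q χ (Koszul q χ 0)).r (monomial q χ L) (wedge q χ ⟨∅, Finset.card_empty⟩) := by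
  induction L with
  | nil =>
    rw [listDerivative, map_zero, monomial_nil, envAction_l_apply, envAction_r_apply]
    exact (sub_self _).symm
  | cons i L ih =>
    rw [listDerivative, map_add, map_envAction_l, map_envAction_r, ih,
      koszulD_wedgeOne χ hq_diag, monomial_cons, BimoduleAction.mul_l, BimoduleAction.r_mul,
      map_sub, map_sub, BimoduleAction.comm]
    abel

theorem koszulD_smul (m : ℕ) (c : 𝕜) (y : Koszul q χ (m + 1)) :
    koszulD q χ m (c • y) = c • koszulD q χ m y := by
  rw [← algebraMap_smul (Env q χ) c y, map_smul, algebraMap_smul]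

/-- The Koszul differential as a map of vector spaces. -/
def koszulDLin (q : Fin k → Fin k → 𝕜ˣ) (χ : Fin k → G →* 𝕜ˣ) (m : ℕ) :
    Koszul q χ (m + 1) →ₗ[𝕜] Koszul q χ m where
  toFun := koszulD q χ m
  map_add' := map_add _
  map_smul' := koszulD_smul χ m

theorem koszulD_psiOne (a : QSym q χ) : koszulD q χ 0 (psiOne χ hq_diag hq_inv a) =
    (envAction q χ (Koszul q χ 0)).l a (wedge q χ ⟨∅, Finset.card_empty⟩) -
      (envAction q χ (Koszul q χ 0)).r a (wedge q χ ⟨∅, Finset.card_empty⟩) := by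
  have : orderedSpan q χ (fun _ => True) ≤ LinearMap.eqLocus
      (koszulDLin q χ 0 ∘ₗ psiOne χ hq_diag hq_inv)
      ((envAction q χ (Koszul q χ 0)).l.flip (wedge q χ ⟨∅, Finset.card_empty⟩) -
        (envAction q χ (Koszul q χ 0)).r.flip (wedge q χ ⟨∅, Finset.card_empty⟩)) := by
    refine Submodule.span_le.2 ?_
    rintro _ ⟨L, hL, -, rfl⟩
    rw [SetLike.mem_coe, LinearMap.mem_eqLocus, LinearMap.comp_apply, psiOne_monomial _ _ _ hL]
    exact koszulD_listDerivative χ hq_diag L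
  rw [orderedSpan_true] at this
  exact this (Submodule.mem_top (x := a))

/-- The coboundary of `Ψ₁` on `w_i ⊗ s`, when `w_i s` is ordered. -/
theorem coboundary_psiOne_of_le {i : Fin k} {s : QSym q χ} (hs : s ∈ orderedSpan q χ (· ≤ i)) :
    (envAction q χ (Koszul q χ 1)).coboundary (psiOne χ hq_diag hq_inv) (gen q χ i) s =
      (envAction q χ (Koszul q χ 1)).r s (psiOne χ hq_diag hq_inv (gen q χ i) -
        wedgeOne q χ i) := by
  have : orderedSpan q χ (· ≤ i) ≤ LinearMap.eqLocus
      ((envAction q χ (Koszul q χ 1)).coboundary (psiOne χ hq_diag hq_inv) (gen q χ i))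
      ((envAction q χ (Koszul q χ 1)).r.flip (psiOne χ hq_diag hq_inv (gen q χ i) -
        wedgeOne q χ i)) := by
    refine Submodule.span_le.2 ?_
    rintro _ ⟨L, hL, hp, rfl⟩
    rw [SetLike.mem_coe, LinearMap.mem_eqLocus, BimoduleAction.coboundary_apply, ← monomial_cons,
      psiOne_monomial _ _ _ hL, psiOne_monomial _ _ _ (List.pairwise_cons.2 ⟨hp, hL⟩),
      listDerivative, LinearMap.flip_apply, map_sub]
    abel
  exact this hs

theorem envAction_r_one {N : Type*} [AddCommGroup N] [Module 𝕜 N] [Module (Env q χ) N]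
    [IsScalarTower 𝕜 (Env q χ) N] (x : N) : (envAction q χ N).r 1 x = x :=
  one_smul (Env q χ) x

theorem psiOne_gen (i : Fin k) : psiOne χ hq_diag hq_inv (gen q χ i) = wedgeOne q χ i := by
  have h := psiOne_monomial χ hq_diag hq_inv (L := [i]) (by simp)
  simpa [listDerivative, envAction_r_one] using h

theorem psiOne_one : psiOne χ hq_diag hq_inv 1 = 0 :=
  psiOne_monomial χ hq_diag hq_inv (L := []) (by simp)

theorem coboundary_psiOne_eq_zero {i : Fin k} {s : QSym q χ}
    (hs : s ∈ orderedSpan q χ (· ≤ i)) :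
    (envAction q χ (Koszul q χ 1)).coboundary (psiOne χ hq_diag hq_inv) (gen q χ i) s = 0 := by
  rw [coboundary_psiOne_of_le χ hq_diag hq_inv hs, psiOne_gen, sub_self, map_zero]

/-- The coboundary of `Ψ₁` vanishes on `w_i ⊗ s` when no letter of `s` exceeds `i`, and each swap of
`w_i` with a larger `w_j` contributes `d(w_i ∧ w_j)`. This is the recursion of `moveError`, so it
fixes what `d Ψ₂` has to be. -/
theorem coboundary_psiOne_gen (i : Fin k) :
    (envAction q χ (Koszul q χ 1)).coboundary (psiOne χ hq_diag hq_inv) (gen q χ i) =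
      (envAction q χ (Koszul q χ 1)).moveErrorLin hq_diag hq_inv
        (fun i j => koszulD q χ 1 (wedgeTwo q χ i j)) i := by
  set A := envAction q χ (Koszul q χ 1) with hA
  set ψ := psiOne χ hq_diag hq_inv with hψ
  have main : ∀ L : List (Fin k), L.Pairwise (· ≥ ·) →
      A.coboundary ψ (gen q χ i) (monomial q χ L) = A.moveErrorLin hq_diag hq_inv
        (fun i j => koszulD q χ 1 (wedgeTwo q χ i j)) i (monomial q χ L) := by
    intro L
    induction L with
    | nil =>
      intro _
      have h := monomial_mem_orderedSpan q χ (p := (· ≤ i)) (L := []) (by simp) (by simp)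
      rw [coboundary_psiOne_eq_zero χ hq_diag hq_inv h, A.moveErrorLin_of_le hq_diag hq_inv _ h]
    | cons j L ih =>
      intro hL
      obtain ⟨hj, hL'⟩ := List.pairwise_cons.1 hL
      rcases le_or_gt j i with hji | hij
      · have h := monomial_mem_orderedSpan q χ (p := (· ≤ i)) hL (by
          simpa [hji] using fun a ha => (hj a ha).trans hji)
        rw [coboundary_psiOne_eq_zero χ hq_diag hq_inv h, A.moveErrorLin_of_le hq_diag hq_inv _ h]
      · have hs : monomial q χ L ∈ orderedSpan q χ (· ≤ j) :=
          monomial_mem_orderedSpan q χ hL' hj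
        -- Both `w_j (w_i s)` and `w_j s` have their largest letter in front, so `Ψ₁` satisfies the
        -- Leibniz rule on them.
        have e1 := coboundary_psiOne_eq_zero χ hq_diag hq_inv
          (gen_mul_mem_orderedSpan q χ hij.le hs)
        have e2 := coboundary_psiOne_eq_zero χ hq_diag hq_inv hs
        have e3 := ih hL'
        rw [← hψ, ← hA, A.coboundary_apply, psiOne_gen, sub_add_eq_add_sub, sub_eq_zero] at e1 e2
        rw [A.coboundary_apply, psiOne_gen, sub_add_eq_add_sub, sub_eq_iff_eq_add] at e3
        rw [monomial_cons, A.moveErrorLin_gen_mul hq_diag hq_inv _ hij hs, A.coboundary_apply,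
          psiOne_gen, ← mul_assoc, gen_mul_gen q χ i j, smul_mul_assoc, mul_assoc, map_smul,
          ← e1, ← e2, koszulD_wedgeTwo χ hq_diag hij, ← hA]
        have e4 := congrArg (fun x => (q i j : 𝕜) • A.l (gen q χ j) x) e3
        have e5 := congrArg (fun a => A.l a (ψ (monomial q χ L))) (gen_mul_gen q χ i j)
        simp only [map_add, map_sub, map_smul, LinearMap.smul_apply, A.comm, A.r_mul, A.mul_l]
          at e4 e5 ⊢
        linear_combination (norm := module) e5 + e4
  have htop : orderedSpan q χ (fun _ => True) ≤ LinearMap.eqLocus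
      (A.coboundary ψ (gen q χ i)) (A.moveErrorLin hq_diag hq_inv
        (fun i j => koszulD q χ 1 (wedgeTwo q χ i j)) i) := by
    refine Submodule.span_le.2 ?_
    rintro _ ⟨L, hL, -, rfl⟩
    exact main L hL
  rw [orderedSpan_true] at htop
  exact LinearMap.ext fun s => htop (Submodule.mem_top (x := s))

end

/-! ### Existence of a normalized chain map in degrees at most three -/

section

variable {𝕜 : Type u} [Field 𝕜] {G : Type v} [Group G] {k : ℕ}
  {q : Fin k → Fin k → 𝕜ˣ} (χ : Fin k → G →* 𝕜ˣ)
  (hq_diag : ∀ i, q i i = 1) (hq_inv : ∀ i j, q j i = (q i j)⁻¹)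

/-- The coefficient of `w_i`. -/
def genCoeff (i : Fin k) : QSym q χ →ₗ[𝕜] 𝕜 :=
  onMonomials χ hq_diag hq_inv (fun L => if L = [i] then 1 else 0)

theorem genCoeff_gen (i j : Fin k) :
    genCoeff χ hq_diag hq_inv i (gen q χ j) = if j = i then 1 else 0 := by
  have h := onMonomials_monomial χ hq_diag hq_inv (fun L => if L = [i] then (1 : 𝕜) else 0) [j]
    (by simp)
  rw [genCoeff]
  simpa using h

/-- `K_2` modulo the image of the differential. -/
abbrev KoszulTwoQuot (q : Fin k → Fin k → 𝕜ˣ) (χ : Fin k → G →* 𝕜ˣ) : Type u :=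
  Koszul q χ 2 ⧸ LinearMap.range (koszulD q χ 2)

/-- The cocycle expression is the image of `d(w_i ∧ w_j ∧ w_m)`, which dies in the quotient. -/
theorem isKoszulCocycle_mkQ (hq_diag : ∀ i, q i i = 1) :
    (envAction q χ (KoszulTwoQuot q χ)).IsKoszulCocycle
      (fun i j => (LinearMap.range (koszulD q χ 2)).mkQ (wedgeTwo q χ i j)) := by
  intro i j m hij hjm
  have h : (LinearMap.range (koszulD q χ 2)).mkQ
      (koszulD q χ 2 (wedge q χ ⟨{i, j, m}, Subs.card_triple hij hjm⟩)) = 0 := by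
    rw [Submodule.mkQ_apply, Submodule.Quotient.mk_eq_zero]
    exact LinearMap.mem_range_self _ _
  have hs : ∀ (c : 𝕜) (y : Koszul q χ 2), (LinearMap.range (koszulD q χ 2)).mkQ (c • y) =
      c • (LinearMap.range (koszulD q χ 2)).mkQ y := fun c y => rfl
  rw [koszulD_wedge_triple χ hq_diag hij hjm] at h
  simpa only [map_add, map_sub, hs, map_envAction_l, map_envAction_r] using h

/-- The bar differential of a bilinear cochain. -/
def barDelta {S B : Type*} [Ring S] [Algebra 𝕜 S] [AddCommGroup B] [Module 𝕜 B]
    (A : BimoduleAction 𝕜 S B) (f : S →ₗ[𝕜] S →ₗ[𝕜] B) : S →ₗ[𝕜] S →ₗ[𝕜] S →ₗ[𝕜] B :=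
  LinearMap.mk₂ 𝕜 (fun a b => A.l a ∘ₗ f b - f (a * b) + f a ∘ₗ LinearMap.mulLeft 𝕜 b -
      A.r.flip (f a b))
    (by intros; ext; simp [add_mul]; abel)
    (by intros; ext; simp [smul_sub])
    (by intros; ext; simp [mul_add, add_mul]; abel)
    (by intros; ext; simp [smul_sub])

/-- `Ψ₂` is found first modulo the boundaries of `K_3`, as the Hochschild cocycle attached to the
tautological Koszul cocycle. Any linear lift to `K_2` has its bar differential in the image of
`K_3`, so `Ψ₃` exists, and the lift can be corrected by boundaries to reach the normalization. -/
theorem exists_barToKoszul (hq_diag : ∀ i, q i i = 1) (hq_inv : ∀ i j, q j i = (q i j)⁻¹) :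
    ∃ Ψ : BarToKoszul q χ, Ψ.IsNormalized := by
  let A := envAction q χ (KoszulTwoQuot q χ)
  let A₁ := envAction q χ (Koszul q χ 1)
  let A₂ := envAction q χ (Koszul q χ 2)
  let R := LinearMap.range (koszulD q χ 2)
  obtain ⟨f, hf, hf1, hfg⟩ := A.exists_cocycle hq_diag hq_inv (envAction_r_one χ)
    (isKoszulCocycle_mkQ χ hq_diag)
  let d : KoszulTwoQuot q χ →ₗ[Env q χ] Koszul q χ 1 := R.liftQ (koszulD q χ 1) (by
    rintro _ ⟨x, rfl⟩
    exact koszulD_koszulD χ hq_diag x)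
  have hd : ∀ x, d (R.mkQ x) = koszulD q χ 1 x := fun x => R.liftQ_apply _ x
  let dl : KoszulTwoQuot q χ →ₗ[𝕜] Koszul q χ 1 :=
    { toFun := d
      map_add' := map_add d
      map_smul' := fun c x => by
        rw [← algebraMap_smul (Env q χ) c x, map_smul, algebraMap_smul]; rfl }
  have hdl : ∀ x, dl x = d x := fun _ => rfl
  -- Both sides are cocycles, so it suffices to compare them when the first argument is `1` or a
  -- generator.
  have hdf : f.compr₂ dl = A₁.coboundary (psiOne χ hq_diag hq_inv) := by
    refine BimoduleAction.IsCocycle.ext A₁ (fun a b c => ?_) (A₁.isCocycle_coboundary _) ?_ ?_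
    · have h := congrArg d (hf a b c)
      simp only [map_add] at h
      rw [map_envAction_l, map_envAction_r] at h
      exact h
    · ext s
      simp [hf1, A₁.coboundary_apply, psiOne_one, A₁.one_l]
    · intro i
      rw [coboundary_psiOne_gen]
      have key : ∀ L : List (Fin k), dl (A.moveError (fun i j => R.mkQ (wedgeTwo q χ i j)) i L) =
          A₁.moveError (fun i j => koszulD q χ 1 (wedgeTwo q χ i j)) i L := by
        intro L
        induction L with
        | nil => exact map_zero d
        | cons j L ih =>
          rw [BimoduleAction.moveError, BimoduleAction.moveError]
          split_ifs
          · rw [map_add, map_smul, ← ih, hdl, hdl, hdl, map_envAction_l, map_envAction_r, hd]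
          · exact map_zero d
      refine LinearMap.ext fun s => ?_
      rw [LinearMap.compr₂_apply, hfg]
      simp only [BimoduleAction.moveErrorLin, onMonomials, LinearMap.comp_apply,
        Finsupp.linearCombination_apply, Finsupp.sum, map_sum, map_smul]
      exact Finset.sum_congr rfl fun m _ => congrArg (_ • ·) (key _)
  let mk : Koszul q χ 2 →ₗ[𝕜] KoszulTwoQuot q χ := R.mkQ.restrictScalars 𝕜
  have hmk : ∀ x, mk x = R.mkQ x := fun _ => rfl
  obtain ⟨s, hs⟩ := mk.exists_rightInverse_of_surjective
    (LinearMap.range_eq_top.2 (Submodule.mkQ_surjective R))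
  have hs' : ∀ x, mk (s x) = x := fun x => LinearMap.congr_fun hs x
  -- The correction of the lift at `(w_i, w_j)`. It is a boundary, so adding it, weighted by the
  -- coefficients of `w_i` and `w_j` in the two arguments, does not change the class.
  let v : Fin k → Fin k → Koszul q χ 2 := fun i j =>
    wedgeTwo q χ i j - s (f (gen q χ i) (gen q χ j))
  have hfij : ∀ i j, f (gen q χ i) (gen q χ j) = mk (wedgeTwo q χ i j) := by
    intro i j
    rw [hfg]
    have h := onMonomials_monomial χ hq_diag hq_inv
      (A.moveError (fun i j => R.mkQ (wedgeTwo q χ i j)) i) [j] (by simp)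
    rw [monomial_cons, monomial_nil, mul_one] at h
    refine h.trans ?_
    rw [BimoduleAction.moveError, BimoduleAction.moveError]
    split_ifs with hij
    · rw [map_zero, smul_zero, add_zero]
      exact envAction_r_one χ _
    · rw [wedgeTwo, dif_neg hij, map_zero]
  have hv : ∀ i j, mk (v i j) = 0 := fun i j => by rw [map_sub, hs', hfij, sub_self]
  let P : QSym q χ →ₗ[𝕜] QSym q χ →ₗ[𝕜] Koszul q χ 2 := f.compr₂ s + ∑ i, ∑ j,
    (genCoeff χ hq_diag hq_inv i).smulRight ((genCoeff χ hq_diag hq_inv j).smulRight (v i j))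
  have hP : ∀ a b, P a b = s (f a b) + ∑ i, ∑ j, genCoeff χ hq_diag hq_inv i a •
      genCoeff χ hq_diag hq_inv j b • v i j := fun a b => by
    simp [P, LinearMap.sum_apply]
  have hmP : ∀ a b, mk (P a b) = f a b := fun a b => by
    rw [hP, map_add, hs', map_sum]
    simp [map_sum, hv]
  have hPg : ∀ i j, P (gen q χ i) (gen q χ j) = wedgeTwo q χ i j := fun i j => by
    rw [hP]
    simp [genCoeff_gen, v]
  -- A linear section of the differential over its image, extended to all of `K_2`; `Ψ₃` is this
  -- extension applied to the bar differential of `Ψ₂`.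
  obtain ⟨e, he⟩ := (koszulDLin q χ 2).rangeRestrict.exists_rightInverse_of_surjective
    (LinearMap.range_rangeRestrict _)
  obtain ⟨e', he'⟩ := e.exists_extend
  have hee : ∀ y, koszulD q χ 2 (e' (koszulD q χ 2 y)) = koszulD q χ 2 y := by
    intro y
    have h1 := LinearMap.congr_fun he' ((koszulDLin q χ 2).rangeRestrict y)
    have h2 := LinearMap.congr_fun he ((koszulDLin q χ 2).rangeRestrict y)
    have h3 := congrArg Subtype.val h2
    rw [LinearMap.comp_apply, ← h1] at h3
    exact h3
  have hbar : ∀ a b c, barDelta A₂ P a b c =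
      A₂.l a (P b c) - P (a * b) c + P a (b * c) - A₂.r c (P a b) := fun _ _ _ => rfl
  refine ⟨⟨psiOne χ hq_diag hq_inv, P,
    (LinearMap.llcomp 𝕜 _ _ _ ((LinearMap.llcomp 𝕜 _ _ _ e'))) ∘ₗ barDelta A₂ P,
    fun a => ?_, fun a b => ?_, fun a b c => ?_⟩, ?_, ?_⟩
  · rw [koszulD_psiOne, sub_smul]
    rfl
  · rw [← hd]
    change dl (mk (P a b)) = _
    rw [hmP]
    exact LinearMap.congr_fun₂ hdf a b
  · change koszulD q χ 2 (e' (barDelta A₂ P a b c)) = barDelta A₂ P a b c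
    have hm : R.mkQ (barDelta A₂ P a b c) = 0 := by
      rw [hbar, map_sub, map_add, map_sub, map_envAction_l, map_envAction_r]
      simp only [← hmk, hmP]
      have h := hf a b c
      rw [sub_add_eq_add_sub, sub_sub, sub_eq_zero]
      exact h
    obtain ⟨y, hy⟩ : barDelta A₂ P a b c ∈ R := (Submodule.Quotient.mk_eq_zero R).1 hm
    rw [← hy, hee]
  · intro i j h
    change P _ _ = _
    rw [hPg, wedgeTwo, dif_pos h]
  · intro i j h
    change P _ _ = _
    rw [hPg, wedgeTwo, dif_neg (not_lt.2 h)]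

end

/-! ### Comparison of cochains on the bar and on the Koszul resolution -/

section

variable {𝕜 : Type u} [Field 𝕜] {G : Type v} [Group G] {k : ℕ}
  (q : Fin k → Fin k → 𝕜ˣ) (χ : Fin k → G →* 𝕜ˣ)

/-- The Hochschild 2-cocycles with values in a bimodule, as a subspace. -/
def BimoduleAction.cocycles {𝕜 S B : Type*} [Field 𝕜] [Ring S] [Algebra 𝕜 S] [AddCommGroup B]
    [Module 𝕜 B] (A : BimoduleAction 𝕜 S B) : Submodule 𝕜 (S →ₗ[𝕜] S →ₗ[𝕜] B) where
  carrier := {f | A.IsCocycle f}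
  zero_mem' := fun a b c => by simp
  add_mem' := by
    intro f f' hf hf' a b c
    simp only [LinearMap.add_apply, map_add]
    calc _ = (A.l a (f b c) + f a (b * c)) + (A.l a (f' b c) + f' a (b * c)) := by abel
      _ = _ := by rw [hf a b c, hf' a b c]; abel
  smul_mem' := by
    intro r f hf a b c
    simp only [LinearMap.smul_apply, map_smul, ← smul_add, hf a b c]

/-- The antisymmetrization of a Hochschild 2-cocycle on generators is a 2-cocycle on the Koszul
complex. -/
theorem BimoduleAction.IsCocycle.isKoszulCocycle {q : Fin k → Fin k → 𝕜ˣ}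
    {χ : Fin k → G →* 𝕜ˣ} {B : Type*} [AddCommGroup B] [Module 𝕜 B]
    {A : BimoduleAction 𝕜 (QSym q χ) B} {f : QSym q χ →ₗ[𝕜] QSym q χ →ₗ[𝕜] B}
    (hf : A.IsCocycle f) :
    A.IsKoszulCocycle (fun i j => f (gen q χ i) (gen q χ j) -
      (q i j : 𝕜) • f (gen q χ j) (gen q χ i)) := by
  intro i j m hij hjm
  have h1 := hf (gen q χ i) (gen q χ j) (gen q χ m)
  have h2 := hf (gen q χ j) (gen q χ i) (gen q χ m)
  have h3 := hf (gen q χ i) (gen q χ m) (gen q χ j)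
  have h4 := hf (gen q χ j) (gen q χ m) (gen q χ i)
  have h5 := hf (gen q χ m) (gen q χ i) (gen q χ j)
  have h6 := hf (gen q χ m) (gen q χ j) (gen q χ i)
  simp only [gen_mul_gen q χ i j, gen_mul_gen q χ i m, gen_mul_gen q χ j m, map_smul,
    LinearMap.smul_apply] at h1 h2 h3 h4 h5 h6
  simp only [map_sub, map_smul]
  -- The six orderings of `w_i, w_j, w_m`, each with the sign of the permutation and the scalar that
  -- relates its product to `w_i w_j w_m`.
  linear_combination (norm := module) h1 - (q i j : 𝕜) • h2 - (q j m : 𝕜) • h3 +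
    ((q i j : 𝕜) * q i m) • h4 + ((q j m : 𝕜) * q i m) • h5 -
    ((q i j : 𝕜) * q i m * q j m) • h6

/-- The smash product as a bimodule over `S_q(V)`. -/
def smashAction : BimoduleAction 𝕜 (QSym q χ) (Smash q χ) where
  l := LinearMap.mul 𝕜 (Smash q χ) ∘ₗ incl q χ
  r := (LinearMap.mul 𝕜 (Smash q χ)).flip ∘ₗ incl q χ
  one_l x := one_mul x
  mul_l a b x := by simp [incl_mul, mul_assoc]
  r_mul a b x := by simp [incl_mul, mul_assoc]
  comm a b x := by simp [mul_assoc]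

theorem smashAction_l_apply (a : QSym q χ) (x : Smash q χ) :
    (smashAction q χ).l a x = incl q χ a * x := rfl

theorem smashAction_r_apply (a : QSym q χ) (x : Smash q χ) :
    (smashAction q χ).r a x = x * incl q χ a := rfl

theorem smashAction_r_one (x : Smash q χ) : (smashAction q χ).r 1 x = x := mul_one x

variable {q χ}

theorem sandwich_tmul (x : Smash q χ) (a : QSym q χ) (b : (QSym q χ)ᵐᵒᵖ) :
    sandwich q χ x (a ⊗ₜ b) = incl q χ a * x * incl q χ (unop b) := rfl

theorem koszulEval_single (m : ℕ) (κ : KCochain q χ m) (β : Subs k m) (e : Env q χ) :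
    koszulEval q χ m κ (Finsupp.single β e) = sandwich q χ (κ β) e := by
  simp [koszulEval]

theorem sandwich_one (x : Smash q χ) : sandwich q χ x 1 = x :=
  (mul_one (1 * x)).trans (one_mul x)

theorem sandwich_mul (x : Smash q χ) (e e' : Env q χ) :
    sandwich q χ x (e * e') = sandwich q χ (sandwich q χ x e') e := by
  induction e using TensorProduct.induction_on with
  | zero => simp
  | add e₁ e₂ h₁ h₂ => simp only [add_mul, map_add, h₁, h₂]
  | tmul a b =>
    induction e' using TensorProduct.induction_on with
    | zero => simp
    | add e₁ e₂ h₁ h₂ => simp only [mul_add, map_add, h₁, h₂, LinearMap.add_apply]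
    | tmul a' b' =>
      rw [Algebra.TensorProduct.tmul_mul_tmul]
      simp only [sandwich_tmul, incl_mul, unop_mul, mul_assoc]

theorem koszulEval_smul (m : ℕ) (κ : KCochain q χ m) (e : Env q χ) (x : Koszul q χ m) :
    koszulEval q χ m κ (e • x) = sandwich q χ (koszulEval q χ m κ x) e := by
  induction x using Finsupp.induction_linear with
  | zero => simp
  | add x y hx hy => simp only [smul_add, map_add, hx, hy, LinearMap.add_apply]
  | single β e' =>
    rw [Finsupp.smul_single, koszulEval_single, koszulEval_single, smul_eq_mul, sandwich_mul]

theorem koszulEval_l (m : ℕ) (κ : KCochain q χ m) (a : QSym q χ) (x : Koszul q χ m) :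
    koszulEval q χ m κ ((envAction q χ (Koszul q χ m)).l a x) =
      (smashAction q χ).l a (koszulEval q χ m κ x) := by
  rw [envAction_l_apply, koszulEval_smul, sandwich_tmul, smashAction_l_apply]
  exact mul_one _

theorem koszulEval_r (m : ℕ) (κ : KCochain q χ m) (a : QSym q χ) (x : Koszul q χ m) :
    koszulEval q χ m κ ((envAction q χ (Koszul q χ m)).r a x) =
      (smashAction q χ).r a (koszulEval q χ m κ x) := by
  rw [envAction_r_apply, koszulEval_smul, sandwich_tmul, smashAction_r_apply]
  exact congrArg (· * _) (one_mul _)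

theorem koszulEval_wedge (m : ℕ) (κ : KCochain q χ m) (β : Subs k m) :
    koszulEval q χ m κ (wedge q χ β) = κ β := by
  rw [wedge, koszulEval_single, sandwich_one]

theorem koszulEval_koszulDelta (m : ℕ) (κ : KCochain q χ m) (x : Koszul q χ (m + 1)) :
    koszulEval q χ (m + 1) (koszulDelta q χ m κ) x = koszulEval q χ m κ (koszulD q χ m x) := by
  induction x using Finsupp.induction_linear with
  | zero => simp
  | add x y hx hy => simp only [map_add, hx, hy]
  | single β e =>
    have h : (Finsupp.single β e : Koszul q χ (m + 1)) = e • wedge q χ β := by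
      rw [wedge, Finsupp.smul_single, smul_eq_mul, mul_one]
    rw [h, koszulEval_smul, koszulEval_wedge, map_smul, koszulEval_smul]
    rfl

/-- The value of a Koszul 2-cochain on `w_i ∧ w_j` for `i < j`, and `0` for `i ≥ j`. -/
def KCochain.value (κ : KCochain q χ 2) (i j : Fin k) : Smash q χ :=
  koszulEval q χ 2 κ (wedgeTwo q χ i j)

theorem KCochain.value_of_lt (κ : KCochain q χ 2) {i j : Fin k} (h : i < j) :
    κ.value i j = κ ⟨{i, j}, Finset.card_pair h.ne⟩ := by
  rw [KCochain.value, wedgeTwo, dif_pos h, koszulEval_wedge]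

theorem KCochain.ext_value {κ κ' : KCochain q χ 2}
    (h : ∀ i j, i < j → κ.value i j = κ'.value i j) : κ = κ' := by
  funext β
  obtain ⟨i, j, hij, rfl⟩ := β.exists_pair
  rw [← κ.value_of_lt hij, ← κ'.value_of_lt hij, h i j hij]

theorem mem_koszulCocycles_iff (hq_diag : ∀ i, q i i = 1) (κ : KCochain q χ 2) :
    κ ∈ koszulCocycles q χ ↔ (smashAction q χ).IsKoszulCocycle κ.value := by
  have key : ∀ {i j m : Fin k} (hij : i < j) (hjm : j < m),
      koszulDelta q χ 2 κ ⟨{i, j, m}, Subs.card_triple hij hjm⟩ =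
      (smashAction q χ).l (gen q χ i) (κ.value j m)
      - ((q i j : 𝕜) * q i m) • (smashAction q χ).r (gen q χ i) (κ.value j m)
      - (q i j : 𝕜) • (smashAction q χ).l (gen q χ j) (κ.value i m)
      + (q j m : 𝕜) • (smashAction q χ).r (gen q χ j) (κ.value i m)
      + ((q i m : 𝕜) * q j m) • (smashAction q χ).l (gen q χ m) (κ.value i j)
      - (smashAction q χ).r (gen q χ m) (κ.value i j) := by
    intro i j m hij hjm
    rw [← koszulEval_wedge 3 (koszulDelta q χ 2 κ), koszulEval_koszulDelta, koszulD_wedge_triple χ hq_diag hij hjm]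
    simp only [map_add, map_sub, map_smul, koszulEval_l, koszulEval_r, KCochain.value]
  constructor
  · intro h i j m hij hjm
    rw [← key hij hjm]
    exact congrFun (LinearMap.mem_ker.1 h) _
  · intro h
    refine LinearMap.mem_ker.2 (funext fun β => ?_)
    obtain ⟨i, j, m, hij, hjm, hβ⟩ := Subs.exists_triple β
    obtain rfl : β = ⟨{i, j, m}, Subs.card_triple hij hjm⟩ := Subtype.ext hβ
    rw [key hij hjm, h i j m hij hjm]
    rfl

/-- The Koszul 2-cochain `w_i ∧ w_j ↦ γ(w_i, w_j) - q_ij γ(w_j, w_i)`. -/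
def koszulPart (γ : QSym q χ →ₗ[𝕜] QSym q χ →ₗ[𝕜] Smash q χ) : KCochain q χ 2 := fun β =>
  have hβ : β.1.Nonempty := Finset.card_pos.1 (by rw [β.2]; decide)
  γ (gen q χ (β.1.min' hβ)) (gen q χ (β.1.max' hβ)) -
    (q (β.1.min' hβ) (β.1.max' hβ) : 𝕜) • γ (gen q χ (β.1.max' hβ)) (gen q χ (β.1.min' hβ))

theorem koszulPart_value (γ : QSym q χ →ₗ[𝕜] QSym q χ →ₗ[𝕜] Smash q χ) {i j : Fin k}
    (h : i < j) : (koszulPart γ).value i j =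
      γ (gen q χ i) (gen q χ j) - (q i j : 𝕜) • γ (gen q χ j) (gen q χ i) := by
  rw [KCochain.value_of_lt _ h]
  simp only [koszulPart, Finset.min'_pair, Finset.max'_pair, min_eq_left h.le, max_eq_right h.le]

theorem koszulPart_mem_koszulCocycles (hq_diag : ∀ i, q i i = 1)
    {γ : QSym q χ →ₗ[𝕜] QSym q χ →ₗ[𝕜] Smash q χ} (hγ : (smashAction q χ).IsCocycle γ) :
    koszulPart γ ∈ koszulCocycles q χ := by
  rw [mem_koszulCocycles_iff hq_diag]
  intro i j m hij hjm
  rw [koszulPart_value γ hij, koszulPart_value γ hjm, koszulPart_value γ (hij.trans hjm)]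
  exact hγ.isKoszulCocycle i j m hij hjm

/-- The terms `h(w_i w_j)` and `q_ij h(w_j w_i)` cancel by the defining relation; the rest is the
Koszul coboundary of `w_i ↦ h(w_i)`. -/
theorem koszulPart_coboundary (hq_diag : ∀ i, q i i = 1) (h : QSym q χ →ₗ[𝕜] Smash q χ) :
    koszulPart ((smashAction q χ).coboundary h) ∈ koszulCoboundaries q χ := by
  let lam : KCochain q χ 1 := fun β =>
    h (gen q χ (β.1.min' (Finset.card_pos.1 (by rw [β.2]; decide))))
  have hlam : ∀ i, koszulEval q χ 1 lam (wedgeOne q χ i) = h (gen q χ i) := fun i => by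
    rw [wedgeOne, koszulEval_wedge]
    simp [lam]
  refine ⟨lam, KCochain.ext_value fun i j hij => ?_⟩
  rw [koszulPart_value _ hij, KCochain.value, koszulEval_koszulDelta,
    koszulD_wedgeTwo χ hq_diag hij]
  simp only [map_add, map_sub, map_smul, koszulEval_l, koszulEval_r, hlam,
    BimoduleAction.coboundary_apply, gen_mul_gen q χ i j]
  module

namespace BarToKoszul

variable (Ψ : BarToKoszul q χ)

theorem pullback_apply (κ : KCochain q χ 2) (a b : QSym q χ) :
    Ψ.pullback κ a b = koszulEval q χ 2 κ (Ψ.toFun2 a b) := rfl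

/-- A Koszul cocycle kills `d Ψ₃`, hence the bar differential of `Ψ₂`. -/
theorem isCocycle_pullback {κ : KCochain q χ 2} (hκ : κ ∈ koszulCocycles q χ) :
    (smashAction q χ).IsCocycle (Ψ.pullback κ) := by
  intro a b c
  have h := congrArg (koszulEval q χ 2 κ) (Ψ.comm3 a b c)
  rw [← koszulEval_koszulDelta, LinearMap.mem_ker.1 hκ, ← envAction_l_apply, ← envAction_r_apply]
    at h
  simp only [map_add, map_sub, map_zero, LinearMap.zero_apply, koszulEval_l, koszulEval_r] at h
  simp only [pullback_apply]
  rw [← sub_eq_zero, h]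
  abel

theorem pullback_koszulDelta (lam : KCochain q χ 1) : Ψ.pullback (koszulDelta q χ 1 lam) =
    (smashAction q χ).coboundary (koszulEval q χ 1 lam ∘ₗ Ψ.toFun1) := by
  refine LinearMap.ext₂ fun a b => ?_
  rw [pullback_apply, koszulEval_koszulDelta, Ψ.comm2, ← envAction_l_apply, ← envAction_r_apply]
  simp only [map_add, map_sub, koszulEval_l, koszulEval_r]
  rfl

/-- By the normalization, `Ψ₂*(κ)(w_j, w_i)` is zero for `i < j` and `Ψ₂*(κ)(w_i, w_j)` is the value
of `κ`. -/
theorem koszulPart_pullback {Ψ : BarToKoszul q χ} (hΨ : Ψ.IsNormalized) (κ : KCochain q χ 2) :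
    koszulPart (Ψ.pullback κ) = κ := by
  refine KCochain.ext_value fun i j hij => ?_
  rw [koszulPart_value _ hij, pullback_apply, pullback_apply, hΨ.of_lt i j hij,
    hΨ.of_ge j i hij.le, koszulEval_wedge, KCochain.value_of_lt _ hij]
  simp

end BarToKoszul

/-- A Hochschild 2-cocycle whose Koszul part vanishes is a coboundary. -/
theorem exists_eq_coboundary (hq_diag : ∀ i, q i i = 1) (hq_inv : ∀ i j, q j i = (q i j)⁻¹)
    {γ : QSym q χ →ₗ[𝕜] QSym q χ →ₗ[𝕜] Smash q χ} (hγ : (smashAction q χ).IsCocycle γ)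
    (h0 : koszulPart γ = 0) : ∃ h, γ = (smashAction q χ).coboundary h := by
  -- A zero Koszul part means that the values of `γ` on generators already satisfy the relations, so
  -- no compensation is needed.
  obtain ⟨e, -, -, he⟩ := (smashAction q χ).exists_primitive γ hγ 0 (by
    refine BimoduleAction.eq_smul_swap hq_diag hq_inv (fun i j => γ (gen q χ i) (gen q χ j) +
      (smashAction q χ).l (gen q χ i) ((0 : Fin k → Smash q χ) j) +
      (smashAction q χ).r (gen q χ j) ((0 : Fin k → Smash q χ) i)) fun i j hij => ?_
    have h := koszulPart_value γ hij
    rw [h0, KCochain.value, map_zero, LinearMap.zero_apply] at h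
    simpa using (sub_eq_zero.1 h.symm))
  refine ⟨-e, LinearMap.ext₂ fun a b => ?_⟩
  rw [BimoduleAction.coboundary_apply, LinearMap.neg_apply, LinearMap.neg_apply, LinearMap.neg_apply, he a b,
    smashAction_r_one, map_neg, map_neg]
  abel

end

/-! ### Invariant cochains and cocycles of the smash product -/

section

variable {𝕜 : Type u} [Field 𝕜] {G : Type v} [Group G] {k : ℕ}
  {q : Fin k → Fin k → 𝕜ˣ} {χ : Fin k → G →* 𝕜ˣ}

theorem single_eq_incl_mul_grp (g : G) (a : QSym q χ) :
    (SkewMonoidAlgebra.single g a : Smash q χ) = incl q χ a * grp q χ g := by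
  simp [incl, grp, SkewMonoidAlgebra.single_mul_single]

/-- Linear maps on the smash product that agree on the elements `a # g` are equal. -/
theorem smash_hom_ext {M : Type*} [AddCommGroup M] [Module 𝕜 M] {f f' : Smash q χ →ₗ[𝕜] M}
    (h : ∀ a g, f (incl q χ a * grp q χ g) = f' (incl q χ a * grp q χ g)) : f = f' := by
  refine LinearMap.ext fun x => ?_
  induction x using SkewMonoidAlgebra.induction_on with
  | zero => simp
  | single g a => rw [single_eq_incl_mul_grp, h]
  | add x y hx hy => rw [map_add, map_add, hx, hy]

theorem conj_apply (g : G) (x : Smash q χ) : conj q χ g x = grp q χ g * x * grp q χ g⁻¹ := rfl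

theorem grp_inv_mul_grp (g : G) : grp q χ g⁻¹ * grp q χ g = 1 := by
  rw [grp_mul_grp, inv_mul_cancel, grp_one]

theorem grp_mul_grp_inv (g : G) : grp q χ g * grp q χ g⁻¹ = 1 := by
  rw [grp_mul_grp, mul_inv_cancel, grp_one]

theorem conj_mul (g : G) (x y : Smash q χ) :
    conj q χ g (x * y) = conj q χ g x * conj q χ g y := by
  simp only [conj_apply, mul_assoc]
  rw [← mul_assoc (grp q χ g⁻¹) (grp q χ g), grp_inv_mul_grp, one_mul]

theorem conj_incl (g : G) (a : QSym q χ) : conj q χ g (incl q χ a) = incl q χ (g • a) := by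
  rw [conj_apply, grp_mul_incl, mul_assoc, grp_mul_grp_inv, mul_one]

theorem conj_conj (g h : G) (x : Smash q χ) : conj q χ g (conj q χ h x) = conj q χ (g * h) x := by
  simp only [conj_apply, mul_inv_rev, ← grp_mul_grp, mul_assoc]

theorem grp_mul_eq_conj_mul (g : G) (x : Smash q χ) :
    grp q χ g * x = conj q χ g x * grp q χ g := by
  rw [conj_apply, mul_assoc, grp_inv_mul_grp, mul_one]

/-- The action of `g ∈ G` on 2-cochains. -/
def cochainAct (g : G) (γ : QSym q χ →ₗ[𝕜] QSym q χ →ₗ[𝕜] Smash q χ) :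
    QSym q χ →ₗ[𝕜] QSym q χ →ₗ[𝕜] Smash q χ :=
  (γ.compl₁₂ (smulLin q χ g⁻¹) (smulLin q χ g⁻¹)).compr₂ (conj q χ g)

theorem cochainAct_apply (g : G) (γ : QSym q χ →ₗ[𝕜] QSym q χ →ₗ[𝕜] Smash q χ)
    (a b : QSym q χ) : cochainAct g γ a b = conj q χ g (γ (g⁻¹ • a) (g⁻¹ • b)) := rfl

theorem cochainAct_mul (g h : G) (γ : QSym q χ →ₗ[𝕜] QSym q χ →ₗ[𝕜] Smash q χ) :
    cochainAct g (cochainAct h γ) = cochainAct (g * h) γ := by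
  refine LinearMap.ext₂ fun a b => ?_
  simp only [cochainAct_apply, conj_conj, mul_inv_rev, mul_smul]

theorem isCocycle_cochainAct (g : G) {γ : QSym q χ →ₗ[𝕜] QSym q χ →ₗ[𝕜] Smash q χ}
    (hγ : (smashAction q χ).IsCocycle γ) : (smashAction q χ).IsCocycle (cochainAct g γ) := by
  intro a b c
  have h := congrArg (conj q χ g) (hγ (g⁻¹ • a) (g⁻¹ • b) (g⁻¹ • c))
  simpa only [smashAction_l_apply, smashAction_r_apply, map_add, conj_mul, conj_incl,
    smul_inv_smul, ← smul_mul', ← cochainAct_apply] using h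

/-- The generators are eigenvectors of `G`, so `g⁻¹` on the two arguments contributes `χ_i(g)⁻¹
χ_j(g)⁻¹`, the factor by which `g` acts on `w_i* ∧ w_j*`. -/
theorem koszulPart_cochainAct (g : G) (γ : QSym q χ →ₗ[𝕜] QSym q χ →ₗ[𝕜] Smash q χ) :
    koszulPart (cochainAct g γ) = koszulAct q χ 2 g (koszulPart γ) := by
  refine KCochain.ext_value fun i j hij => ?_
  rw [koszulPart_value _ hij, KCochain.value_of_lt _ hij, koszulAct_apply,
    ← KCochain.value_of_lt (koszulPart γ) hij, koszulPart_value _ hij, Finset.prod_pair hij.ne]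
  simp only [cochainAct_apply, smul_eq_actHom, actHom_gen, map_smul, LinearMap.smul_apply,
    map_sub, map_inv, Units.val_inv_eq_inv_val]
  module

/-- Invariant 2-cochains. -/
def IsInvariant (γ : QSym q χ →ₗ[𝕜] QSym q χ →ₗ[𝕜] Smash q χ) : Prop :=
  ∀ (g : G) (a b : QSym q χ), conj q χ g (γ a b) = γ (g • a) (g • b)

theorem IsInvariant.cochainAct_eq {γ : QSym q χ →ₗ[𝕜] QSym q χ →ₗ[𝕜] Smash q χ}
    (hγ : IsInvariant γ) (g : G) : cochainAct g γ = γ := by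
  refine LinearMap.ext₂ fun a b => ?_
  rw [cochainAct_apply, hγ, smul_inv_smul, smul_inv_smul]

/-- The restriction of a 2-cochain of the smash product to `S_q(V)`. -/
def restrictSym (F : Smash q χ →ₗ[𝕜] Smash q χ →ₗ[𝕜] Smash q χ) :
    QSym q χ →ₗ[𝕜] QSym q χ →ₗ[𝕜] Smash q χ := F.compl₁₂ (incl q χ) (incl q χ)

theorem restrictSym_apply (F : Smash q χ →ₗ[𝕜] Smash q χ →ₗ[𝕜] Smash q χ) (a b : QSym q χ) :
    restrictSym F a b = F (incl q χ a) (incl q χ b) := rfl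

theorem isCocycle_restrictSym {F : Smash q χ →ₗ[𝕜] Smash q χ →ₗ[𝕜] Smash q χ}
    (hF : F ∈ hochschildCocycles 𝕜 (Smash q χ)) :
    (smashAction q χ).IsCocycle (restrictSym F) := by
  intro a b c
  have h := hF (incl q χ a) (incl q χ b) (incl q χ c)
  rwa [← incl_mul, ← incl_mul] at h

theorem restrictSym_hochschildDelta (H : Smash q χ →ₗ[𝕜] Smash q χ) :
    restrictSym (hochschildDelta 𝕜 (Smash q χ) H) =
      (smashAction q χ).coboundary (H ∘ₗ incl q χ) := by
  refine LinearMap.ext₂ fun a b => ?_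
  rw [BimoduleAction.coboundary_apply, LinearMap.comp_apply (x := a * b), incl_mul]
  rfl

theorem hochschildDelta_apply {A : Type*} [Ring A] [Algebra 𝕜 A] (H : A →ₗ[𝕜] A) (a b : A) :
    hochschildDelta 𝕜 A H a b = a * H b - H (a * b) + H a * b := rfl

theorem hochschildDelta_mem_hochschildCocycles {A : Type*} [Ring A] [Algebra 𝕜 A]
    (H : A →ₗ[𝕜] A) : hochschildDelta 𝕜 A H ∈ hochschildCocycles 𝕜 A := by
  intro a b c
  simp only [hochschildDelta_apply, mul_add, mul_sub, add_mul, sub_mul, mul_assoc]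
  abel

theorem incl_mul_grp_mul (a b : QSym q χ) (g h : G) :
    incl q χ a * grp q χ g * (incl q χ b * grp q χ h) =
      incl q χ (a * g • b) * grp q χ (g * h) := by
  rw [mul_assoc, ← mul_assoc (grp q χ g), grp_mul_incl, mul_assoc, grp_mul_grp, incl_mul,
    mul_assoc]

theorem isInvariant_of_cochainAct_eq {γ : QSym q χ →ₗ[𝕜] QSym q χ →ₗ[𝕜] Smash q χ}
    (h : ∀ g, cochainAct g γ = γ) : IsInvariant γ := by
  intro g a b
  conv_rhs => rw [← h g]
  rw [cochainAct_apply, inv_smul_smul, inv_smul_smul]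

variable [Fintype G]

theorem theta_incl_mul_grp (γ : QSym q χ →ₗ[𝕜] QSym q χ →ₗ[𝕜] Smash q χ) (a b : QSym q χ)
    (g h : G) : theta q χ γ (incl q χ a * grp q χ g) (incl q χ b * grp q χ h) =
      γ a (g • b) * grp q χ (g * h) := by
  rw [← single_eq_incl_mul_grp, ← single_eq_incl_mul_grp, theta_single]

theorem restrictSym_theta (γ : QSym q χ →ₗ[𝕜] QSym q χ →ₗ[𝕜] Smash q χ) :
    restrictSym (theta q χ γ) = γ := by
  refine LinearMap.ext₂ fun a b => ?_
  have h := theta_incl_mul_grp γ a b 1 1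
  rw [restrictSym_apply]
  simpa only [grp_one, mul_one, one_smul] using h

/-- On `a g, b h, c l` all group elements can be pushed to the right, which leaves the identity for
`γ` at `a, g(b), gh(c)` times `ghl`. Invariance is what allows `g` to pass `γ(b, h(c))`. -/
theorem theta_mem_hochschildCocycles {γ : QSym q χ →ₗ[𝕜] QSym q χ →ₗ[𝕜] Smash q χ}
    (hγ : (smashAction q χ).IsCocycle γ) (hinv : IsInvariant γ) :
    theta q χ γ ∈ hochschildCocycles 𝕜 (Smash q χ) := by
  intro x y z
  induction x using SkewMonoidAlgebra.induction_on with
  | zero => simp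
  | add x x' hx hx' =>
    simp only [add_mul, map_add, LinearMap.add_apply]
    calc _ = (x * theta q χ γ y z + theta q χ γ x (y * z)) +
          (x' * theta q χ γ y z + theta q χ γ x' (y * z)) := by abel
      _ = _ := by rw [hx, hx']; abel
  | single g a =>
    induction y using SkewMonoidAlgebra.induction_on with
    | zero => simp
    | add y y' hy hy' =>
      simp only [add_mul, mul_add, map_add, LinearMap.add_apply]
      calc _ = (SkewMonoidAlgebra.single g a * theta q χ γ y z +
              theta q χ γ (SkewMonoidAlgebra.single g a) (y * z)) +
            (SkewMonoidAlgebra.single g a * theta q χ γ y' z +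
              theta q χ γ (SkewMonoidAlgebra.single g a) (y' * z)) := by abel
        _ = _ := by rw [hy, hy']; abel
    | single h b =>
      induction z using SkewMonoidAlgebra.induction_on with
      | zero => simp
      | add z z' hz hz' =>
        simp only [mul_add, map_add]
        calc _ = (SkewMonoidAlgebra.single g a * theta q χ γ (SkewMonoidAlgebra.single h b) z +
              theta q χ γ (SkewMonoidAlgebra.single g a) (SkewMonoidAlgebra.single h b * z)) +
            (SkewMonoidAlgebra.single g a * theta q χ γ (SkewMonoidAlgebra.single h b) z' +
              theta q χ γ (SkewMonoidAlgebra.single g a) (SkewMonoidAlgebra.single h b * z')) := by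
              abel
          _ = _ := by rw [hz, hz']; abel
      | single l c =>
        simp only [single_eq_incl_mul_grp, incl_mul_grp_mul, theta_incl_mul_grp]
        have h1 := congrArg (· * grp q χ (g * (h * l))) (hγ a (g • b) ((g * h) • c))
        simp only [smashAction_l_apply, smashAction_r_apply, add_mul] at h1
        rw [smul_mul', smul_smul]
        rw [mul_assoc g h l]
        convert h1 using 2
        · rw [mul_assoc, ← mul_assoc (grp q χ g), grp_mul_eq_conj_mul, hinv, smul_smul,
            mul_assoc (γ _ _), grp_mul_grp, mul_assoc]
        · rw [mul_assoc, ← mul_assoc (grp q χ (g * h)), grp_mul_incl, mul_assoc, grp_mul_grp,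
            mul_assoc g h l, mul_assoc]

/-- The extension `a g ↦ h(a) g` of a linear map to the smash product. -/
def thetaOne (h : QSym q χ →ₗ[𝕜] Smash q χ) : Smash q χ →ₗ[𝕜] Smash q χ :=
  ∑ g : G, mulRightLin q χ (grp q χ g) ∘ₗ h ∘ₗ coeffLin q χ g

theorem thetaOne_apply (h : QSym q χ →ₗ[𝕜] Smash q χ) (a : QSym q χ) (g : G) :
    thetaOne h (incl q χ a * grp q χ g) = h a * grp q χ g := by
  classical
  rw [← single_eq_incl_mul_grp, thetaOne, LinearMap.sum_apply, Finset.sum_eq_single g]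
  · simp [mulRightLin, coeffLin]
  · intro x _ hx
    simp [coeffLin, hx.symm]
  · simp

/-- The extension `a g ↦ h(a) g` is again compatible with differentials because `h` commutes with
`G`. -/
theorem theta_coboundary {h : QSym q χ →ₗ[𝕜] Smash q χ}
    (hinv : ∀ (g : G) (a : QSym q χ), conj q χ g (h a) = h (g • a)) :
    theta q χ ((smashAction q χ).coboundary h) =
      hochschildDelta 𝕜 (Smash q χ) (thetaOne h) := by
  refine smash_hom_ext fun a g => smash_hom_ext fun b l => ?_
  rw [theta_incl_mul_grp, hochschildDelta_apply, incl_mul_grp_mul, thetaOne_apply, thetaOne_apply,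
    thetaOne_apply, BimoduleAction.coboundary_apply, smashAction_l_apply, smashAction_r_apply,
    add_mul, sub_mul]
  refine congrArg₂ (· + ·) (congrArg₂ (· - ·) ?_ rfl) ?_
  · rw [mul_assoc, mul_assoc, ← mul_assoc (grp q χ g), grp_mul_eq_conj_mul, hinv,
      mul_assoc (h _), grp_mul_grp]
  · rw [mul_assoc, mul_assoc, ← mul_assoc (grp q χ g), grp_mul_incl, mul_assoc, grp_mul_grp]

theorem reynolds_eq (γ : QSym q χ →ₗ[𝕜] QSym q χ →ₗ[𝕜] Smash q χ) :
    reynolds q χ γ = ((Fintype.card G : 𝕜)⁻¹) • ∑ g : G, cochainAct g γ := rfl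

theorem isCocycle_reynolds {γ : QSym q χ →ₗ[𝕜] QSym q χ →ₗ[𝕜] Smash q χ}
    (hγ : (smashAction q χ).IsCocycle γ) : (smashAction q χ).IsCocycle (reynolds q χ γ) :=
  (smashAction q χ).cocycles.smul_mem _
    (Submodule.sum_mem _ fun g _ => isCocycle_cochainAct g hγ)

theorem cochainAct_reynolds (g : G) (γ : QSym q χ →ₗ[𝕜] QSym q χ →ₗ[𝕜] Smash q χ) :
    cochainAct g (reynolds q χ γ) = reynolds q χ γ := by
  refine LinearMap.ext₂ fun a b => ?_
  have h : ∀ x, cochainAct g (cochainAct x γ) a b = cochainAct (g * x) γ a b := fun x => by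
    rw [cochainAct_mul]
  rw [cochainAct_apply]
  simp only [reynolds_eq, LinearMap.smul_apply, LinearMap.sum_apply, map_smul, map_sum]
  refine congrArg _ ?_
  rw [← Equiv.sum_comp (Equiv.mulLeft g) (fun x => cochainAct x γ a b)]
  exact Finset.sum_congr rfl fun x _ => h x

theorem isInvariant_reynolds (γ : QSym q χ →ₗ[𝕜] QSym q χ →ₗ[𝕜] Smash q χ) :
    IsInvariant (reynolds q χ γ) :=
  isInvariant_of_cochainAct_eq fun g => cochainAct_reynolds g γ

/-- The average of a linear map over the group. -/
def reynoldsOne (h : QSym q χ →ₗ[𝕜] Smash q χ) : QSym q χ →ₗ[𝕜] Smash q χ :=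
  ((Fintype.card G : 𝕜)⁻¹) • ∑ g : G, conj q χ g ∘ₗ h ∘ₗ smulLin q χ g⁻¹

theorem reynoldsOne_apply (h : QSym q χ →ₗ[𝕜] Smash q χ) (a : QSym q χ) :
    reynoldsOne h a = ((Fintype.card G : 𝕜)⁻¹) • ∑ g : G, conj q χ g (h (g⁻¹ • a)) := by
  rw [reynoldsOne, LinearMap.smul_apply, LinearMap.sum_apply]
  rfl

theorem conj_reynoldsOne (h : QSym q χ →ₗ[𝕜] Smash q χ) (g : G) (a : QSym q χ) :
    conj q χ g (reynoldsOne h a) = reynoldsOne h (g • a) := by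
  rw [reynoldsOne_apply, reynoldsOne_apply, map_smul, map_sum,
    ← Equiv.sum_comp (Equiv.mulLeft g) (fun x => conj q χ x (h (x⁻¹ • g • a)))]
  simp only [Equiv.coe_mulLeft, conj_conj, mul_inv_rev, mul_smul, inv_smul_smul]

theorem reynolds_coboundary (h : QSym q χ →ₗ[𝕜] Smash q χ) :
    reynolds q χ ((smashAction q χ).coboundary h) =
      (smashAction q χ).coboundary (reynoldsOne h) := by
  refine LinearMap.ext₂ fun a b => ?_
  rw [BimoduleAction.coboundary_apply, reynolds_eq]
  simp only [reynoldsOne_apply, LinearMap.smul_apply, LinearMap.sum_apply, cochainAct_apply,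
    map_smul, map_sum, ← smul_sub, ← smul_add, ← Finset.sum_sub_distrib,
    ← Finset.sum_add_distrib]
  refine congrArg _ (Finset.sum_congr rfl fun g _ => ?_)
  rw [BimoduleAction.coboundary_apply, map_add, map_sub, smashAction_l_apply,
    smashAction_r_apply, conj_mul, conj_mul, conj_incl, conj_incl, smul_inv_smul, smul_inv_smul,
    smul_mul', smashAction_l_apply, smashAction_r_apply]

theorem theta_add (γ γ' : QSym q χ →ₗ[𝕜] QSym q χ →ₗ[𝕜] Smash q χ) :
    theta q χ (γ + γ') = theta q χ γ + theta q χ γ' := by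
  refine smash_hom_ext fun a g => smash_hom_ext fun b l => ?_
  simp only [theta_incl_mul_grp, LinearMap.add_apply, add_mul]

theorem theta_smul (c : 𝕜) (γ : QSym q χ →ₗ[𝕜] QSym q χ →ₗ[𝕜] Smash q χ) :
    theta q χ (c • γ) = c • theta q χ γ := by
  refine smash_hom_ext fun a g => smash_hom_ext fun b l => ?_
  simp only [theta_incl_mul_grp, LinearMap.smul_apply, smul_mul_assoc]

theorem reynolds_add (γ γ' : QSym q χ →ₗ[𝕜] QSym q χ →ₗ[𝕜] Smash q χ) :
    reynolds q χ (γ + γ') = reynolds q χ γ + reynolds q χ γ' := by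
  refine LinearMap.ext₂ fun a b => ?_
  simp only [reynolds_eq, LinearMap.smul_apply, LinearMap.sum_apply, LinearMap.add_apply,
    cochainAct_apply, map_add, Finset.sum_add_distrib, smul_add]

theorem reynolds_smul (c : 𝕜) (γ : QSym q χ →ₗ[𝕜] QSym q χ →ₗ[𝕜] Smash q χ) :
    reynolds q χ (c • γ) = c • reynolds q χ γ := by
  refine LinearMap.ext₂ fun a b => ?_
  simp only [reynolds_eq, LinearMap.smul_apply, LinearMap.sum_apply,
    cochainAct_apply, map_smul, ← Finset.smul_sum]
  rw [smul_comm]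

theorem reynolds_of_isInvariant [CharZero 𝕜] {γ : QSym q χ →ₗ[𝕜] QSym q χ →ₗ[𝕜] Smash q χ}
    (hγ : IsInvariant γ) : reynolds q χ γ = γ := by
  rw [reynolds_eq]
  simp only [hγ.cochainAct_eq, Finset.sum_const, Finset.card_univ]
  rw [← Nat.cast_smul_eq_nsmul 𝕜, smul_smul, inv_mul_cancel₀, one_smul]
  exact Nat.cast_ne_zero.2 Fintype.card_ne_zero

end

/-! ### Cocycles of the smash product that vanish on the group, and the isomorphism -/

section

variable {𝕜 : Type u} [Field 𝕜] {G : Type v} [Group G] {k : ℕ}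
  {q : Fin k → Fin k → 𝕜ˣ} {χ : Fin k → G →* 𝕜ˣ}

/-- 2-cochains of the smash product that vanish when one of the arguments is in the group. -/
def VanishesOnGroup (F : Smash q χ →ₗ[𝕜] Smash q χ →ₗ[𝕜] Smash q χ) : Prop :=
  ∀ (x : Smash q χ) (g : G), F x (grp q χ g) = 0 ∧ F (grp q χ g) x = 0

namespace VanishesOnGroup

variable {F : Smash q χ →ₗ[𝕜] Smash q χ →ₗ[𝕜] Smash q χ}

/-- In the cocycle identity with one argument in `G`, two of the four terms vanish. The three
positions of that argument show that `F` is balanced over `G` and linear over `G` on both sides. -/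
theorem mul_grp_left (hF : VanishesOnGroup F)
    (hc : F ∈ hochschildCocycles 𝕜 (Smash q χ))
    (x y : Smash q χ) (g : G) : F (x * grp q χ g) y = F x (grp q χ g * y) := by
  have h := hc x (grp q χ g) y
  rw [(hF y g).2, (hF x g).1, mul_zero, zero_mul, zero_add, add_zero] at h
  exact h.symm

theorem mul_grp_right (hF : VanishesOnGroup F)
    (hc : F ∈ hochschildCocycles 𝕜 (Smash q χ))
    (x y : Smash q χ) (g : G) : F x (y * grp q χ g) = F x y * grp q χ g := by
  have h := hc x y (grp q χ g)
  rwa [(hF y g).1, (hF (x * y) g).1, mul_zero, zero_add, zero_add] at h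

theorem grp_mul_left (hF : VanishesOnGroup F)
    (hc : F ∈ hochschildCocycles 𝕜 (Smash q χ))
    (x y : Smash q χ) (g : G) : F (grp q χ g * x) y = grp q χ g * F x y := by
  have h := hc (grp q χ g) x y
  rw [(hF (x * y) g).2, (hF x g).2, zero_mul, add_zero, add_zero] at h
  exact h.symm

/-- Balancedness moves `g` from the first argument into the second, and linearity then takes all
group elements out on the right, as in the formula for `θ₂*`. -/
theorem theta_restrictSym [Fintype G] (hF : VanishesOnGroup F)
    (hc : F ∈ hochschildCocycles 𝕜 (Smash q χ)) : theta q χ (restrictSym F) = F := by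
  refine smash_hom_ext fun a g => smash_hom_ext fun b l => ?_
  rw [theta_incl_mul_grp, restrictSym_apply, hF.mul_grp_left hc, ← mul_assoc, grp_mul_incl,
    mul_assoc, grp_mul_grp, hF.mul_grp_right hc]

theorem isInvariant_restrictSym (hF : VanishesOnGroup F)
    (hc : F ∈ hochschildCocycles 𝕜 (Smash q χ)) : IsInvariant (restrictSym F) := by
  intro g a b
  rw [restrictSym_apply, restrictSym_apply, conj_apply, ← hF.grp_mul_left hc,
    ← hF.mul_grp_right hc, grp_mul_incl, hF.mul_grp_left hc, ← mul_assoc, ← conj_apply, conj_incl]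

theorem koszulAct_koszulPart (hF : VanishesOnGroup F)
    (hc : F ∈ hochschildCocycles 𝕜 (Smash q χ))
    (g : G) :
    koszulAct q χ 2 g (koszulPart (restrictSym F)) = koszulPart (restrictSym F) := by
  rw [← koszulPart_cochainAct, (hF.isInvariant_restrictSym hc).cochainAct_eq]

end VanishesOnGroup

variable [Fintype G]

theorem average_const [CharZero 𝕜] {M : Type*} [AddCommGroup M] [Module 𝕜 M] (x : M) :
    (Fintype.card G : 𝕜)⁻¹ • ∑ _g : G, x = x := by
  rw [Finset.sum_const, Finset.card_univ, ← Nat.cast_smul_eq_nsmul 𝕜, smul_smul, inv_mul_cancel₀,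
    one_smul]
  exact Nat.cast_ne_zero.2 Fintype.card_ne_zero

/-- The cochain is the average of `F(x, h) h⁻¹` over `h`. Multiplying the cocycle identity for `x,
g, h` on the right by `h⁻¹` and averaging over `h` expresses `F(x, g)` as its coboundary at `(x,
g)`. -/
theorem exists_sub_vanishes_right [CharZero 𝕜] {F : Smash q χ →ₗ[𝕜] Smash q χ →ₗ[𝕜] Smash q χ}
    (hF : F ∈ hochschildCocycles 𝕜 (Smash q χ)) :
    ∃ H, ∀ x (g : G), (F - hochschildDelta 𝕜 (Smash q χ) H) x (grp q χ g) = 0 := by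
  let H : Smash q χ →ₗ[𝕜] Smash q χ := ((Fintype.card G : 𝕜)⁻¹) •
    ∑ h : G, mulRightLin q χ (grp q χ h⁻¹) ∘ₗ F.flip (grp q χ h)
  have hH : ∀ x, H x = ((Fintype.card G : 𝕜)⁻¹) • ∑ h : G, F x (grp q χ h) * grp q χ h⁻¹ :=
    fun x => by
      simp only [H, LinearMap.smul_apply, LinearMap.sum_apply]
      rfl
  refine ⟨H, fun x g => ?_⟩
  have h1 : ∀ h : G, F x (grp q χ g) = x * (F (grp q χ g) (grp q χ h) * grp q χ h⁻¹) -
      F (x * grp q χ g) (grp q χ h) * grp q χ h⁻¹ + F x (grp q χ (g * h)) * grp q χ h⁻¹ := by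
    intro h
    have h2 := congrArg (· * grp q χ h⁻¹) (hF x (grp q χ g) (grp q χ h))
    simp only [add_mul, mul_assoc, mul_one, grp_mul_grp, mul_inv_cancel, grp_one] at h2
    rw [← sub_eq_zero] at h2 ⊢
    rw [← neg_eq_zero, ← h2]
    abel
  have h3 : ∑ h : G, F x (grp q χ (g * h)) * grp q χ h⁻¹ =
      (∑ h : G, F x (grp q χ h) * grp q χ h⁻¹) * grp q χ g := by
    rw [Finset.sum_mul, ← Equiv.sum_comp (Equiv.mulLeft g)
      (fun h => F x (grp q χ h) * grp q χ h⁻¹ * grp q χ g)]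
    refine Finset.sum_congr rfl fun h _ => ?_
    rw [Equiv.coe_mulLeft, mul_assoc, grp_mul_grp, mul_inv_rev, inv_mul_cancel_right]
  rw [LinearMap.sub_apply, LinearMap.sub_apply, sub_eq_zero, hochschildDelta_apply, hH, hH, hH,
    smul_mul_assoc, ← h3, mul_smul_comm, ← smul_sub, ← smul_add, Finset.mul_sum,
    ← Finset.sum_sub_distrib, ← Finset.sum_add_distrib]
  simp only [← h1]
  rw [average_const]

/-- A second correction, by the average of `h⁻¹ F₁(h, x)`, treats the first argument. It keeps the
vanishing in the second one, because it is zero on `G` and commutes with right multiplication by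
`G`. -/
theorem exists_sub_vanishesOnGroup [CharZero 𝕜] {F : Smash q χ →ₗ[𝕜] Smash q χ →ₗ[𝕜] Smash q χ}
    (hF : F ∈ hochschildCocycles 𝕜 (Smash q χ)) :
    ∃ H, VanishesOnGroup (F - hochschildDelta 𝕜 (Smash q χ) H) := by
  obtain ⟨H₁, hH₁⟩ := exists_sub_vanishes_right hF
  set F₁ := F - hochschildDelta 𝕜 (Smash q χ) H₁ with hF₁
  have hc : F₁ ∈ hochschildCocycles 𝕜 (Smash q χ) :=
    Submodule.sub_mem _ hF (hochschildDelta_mem_hochschildCocycles H₁)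
  let H : Smash q χ →ₗ[𝕜] Smash q χ := ((Fintype.card G : 𝕜)⁻¹) •
    ∑ h : G, LinearMap.mulLeft 𝕜 (grp q χ h⁻¹) ∘ₗ F₁ (grp q χ h)
  have hH : ∀ x, H x = ((Fintype.card G : 𝕜)⁻¹) • ∑ h : G, grp q χ h⁻¹ * F₁ (grp q χ h) x :=
    fun x => by
      simp only [H, LinearMap.smul_apply, LinearMap.sum_apply]
      rfl
  have hHg : ∀ g, H (grp q χ g) = 0 := fun g => by
    rw [hH]
    simp [hH₁]
  refine ⟨H₁ + H, fun x g => ?_⟩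
  rw [map_add, ← sub_sub, ← hF₁]
  simp only [LinearMap.sub_apply, hH₁, hochschildDelta_apply, hHg, mul_zero, zero_mul, add_zero,
    zero_sub]
  constructor
  · rw [neg_eq_zero, neg_add_eq_zero, hH, hH, smul_mul_assoc, Finset.sum_mul]
    refine congrArg _ (Finset.sum_congr rfl fun h _ => ?_)
    have h2 := hc (grp q χ h) x (grp q χ g)
    rw [hH₁, hH₁, mul_zero, zero_add, zero_add] at h2
    rw [h2, mul_assoc]
  · have h1 : ∀ h : G, F₁ (grp q χ g) x = grp q χ h⁻¹ * F₁ (grp q χ (h * g)) x -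
        grp q χ h⁻¹ * F₁ (grp q χ h) (grp q χ g * x) := by
      intro h
      have h2 := congrArg (grp q χ h⁻¹ * ·) (hc (grp q χ h) (grp q χ g) x)
      simp only [mul_add, ← mul_assoc, one_mul, grp_mul_grp, inv_mul_cancel, grp_one, hH₁,
        zero_mul, add_zero] at h2
      rw [← h2, add_sub_cancel_right]
    have h3 : ∑ h : G, grp q χ h⁻¹ * F₁ (grp q χ (h * g)) x =
        grp q χ g * ∑ h : G, grp q χ h⁻¹ * F₁ (grp q χ h) x := by
      rw [Finset.mul_sum, ← Equiv.sum_comp (Equiv.mulRight g)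
        (fun h => grp q χ g * (grp q χ h⁻¹ * F₁ (grp q χ h) x))]
      refine Finset.sum_congr rfl fun h _ => ?_
      rw [Equiv.coe_mulRight, ← mul_assoc, grp_mul_grp, mul_inv_rev, mul_inv_cancel_left]
    rw [sub_eq_zero, hH, hH, mul_smul_comm, ← h3, ← smul_sub, ← Finset.sum_sub_distrib]
    simp only [← h1]
    rw [average_const]

theorem koszulPart_reynolds (γ : QSym q χ →ₗ[𝕜] QSym q χ →ₗ[𝕜] Smash q χ) :
    koszulPart (reynolds q χ γ) =
      (Fintype.card G : 𝕜)⁻¹ • ∑ g : G, koszulAct q χ 2 g (koszulPart γ) := by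
  let L : (QSym q χ →ₗ[𝕜] QSym q χ →ₗ[𝕜] Smash q χ) →ₗ[𝕜] KCochain q χ 2 :=
    { toFun := koszulPart
      map_add' := fun γ γ' => KCochain.ext_value fun i j hij => by
        rw [KCochain.value_of_lt (koszulPart γ + koszulPart γ') hij, Pi.add_apply,
          ← KCochain.value_of_lt (koszulPart γ) hij, ← KCochain.value_of_lt (koszulPart γ') hij,
          koszulPart_value _ hij, koszulPart_value _ hij, koszulPart_value _ hij]
        simp only [LinearMap.add_apply]
        module
      map_smul' := fun c γ => KCochain.ext_value fun i j hij => by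
        rw [RingHom.id_apply, KCochain.value_of_lt (c • koszulPart γ) hij, Pi.smul_apply,
          ← KCochain.value_of_lt (koszulPart γ) hij,
          koszulPart_value _ hij, koszulPart_value _ hij]
        simp only [LinearMap.smul_apply]
        module }
  have h := map_smul L ((Fintype.card G : 𝕜)⁻¹) (∑ g : G, cochainAct g γ)
  rw [map_sum] at h
  simp only [← koszulPart_cochainAct]
  exact h

namespace BarToKoszul

variable (Ψ : BarToKoszul q χ)

theorem transfer_mem_hochschildCocycles {κ : KCochain q χ 2} (hκ : κ ∈ koszulCocycles q χ) :
    Ψ.transfer κ ∈ hochschildCocycles 𝕜 (Smash q χ) :=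
  theta_mem_hochschildCocycles (isCocycle_reynolds (Ψ.isCocycle_pullback hκ))
    (isInvariant_reynolds _)

theorem transfer_mem_hochschildCoboundaries {κ : KCochain q χ 2}
    (hκ : κ ∈ koszulCoboundaries q χ) :
    Ψ.transfer κ ∈ hochschildCoboundaries 𝕜 (Smash q χ) := by
  obtain ⟨lam, rfl⟩ := hκ
  rw [transfer, Ψ.pullback_koszulDelta, reynolds_coboundary,
    theta_coboundary fun g a => conj_reynoldsOne _ g a]
  exact ⟨_, rfl⟩

/-- `θ₂* R₂ Ψ₂*` as a linear map on cochains. -/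
def transferLin : KCochain q χ 2 →ₗ[𝕜] Smash q χ →ₗ[𝕜] Smash q χ →ₗ[𝕜] Smash q χ where
  toFun := Ψ.transfer
  map_add' κ κ' := by
    have h : Ψ.pullback (κ + κ') = Ψ.pullback κ + Ψ.pullback κ' :=
      LinearMap.ext₂ fun a b => by simp [pullback_apply]
    rw [transfer, h, reynolds_add, theta_add]
    rfl
  map_smul' c κ := by
    have h : Ψ.pullback (c • κ) = c • Ψ.pullback κ :=
      LinearMap.ext₂ fun a b => by simp [pullback_apply]
    rw [transfer, h, reynolds_smul, theta_smul]
    rfl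

variable {Ψ}

/-- Injectivity: restricting to `S` and taking Koszul parts turns the image of `κ` into the average
of the `g(κ)`, which differs from `κ` by a coboundary when its class is invariant. -/
theorem mem_koszulCoboundaries_of_transfer [CharZero 𝕜] (hq_diag : ∀ i, q i i = 1) (hΨ : Ψ.IsNormalized)
    {κ : KCochain q χ 2} (hG : ∀ g, koszulAct q χ 2 g κ - κ ∈ koszulCoboundaries q χ)
    (h : Ψ.transfer κ ∈ hochschildCoboundaries 𝕜 (Smash q χ)) :
    κ ∈ koszulCoboundaries q χ := by
  obtain ⟨H, hH⟩ := h
  have h1 := congrArg restrictSym hH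
  rw [transfer, restrictSym_theta, restrictSym_hochschildDelta] at h1
  have h2 := koszulPart_coboundary hq_diag (H ∘ₗ incl q χ)
  rw [h1, koszulPart_reynolds, koszulPart_pullback hΨ] at h2
  have h3 := Submodule.smul_mem (koszulCoboundaries q χ) ((Fintype.card G : 𝕜)⁻¹)
    (Submodule.sum_mem (koszulCoboundaries q χ) (t := Finset.univ) fun g _ => hG g)
  have h4 := Submodule.sub_mem _ h2 h3
  rwa [Finset.sum_sub_distrib, smul_sub, average_const, sub_sub_cancel] at h4

/-- Surjectivity: `Ψ₂*` of the Koszul part of `F|_S` differs from `F|_S` by a cocycle with zero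
Koszul part, hence by a coboundary. Averaging and `θ₂*` preserve this relation, and they turn `F|_S`
back into `F`. -/
theorem transfer_koszulPart_sub_mem [CharZero 𝕜] (hq_diag : ∀ i, q i i = 1)
    (hq_inv : ∀ i j, q j i = (q i j)⁻¹) (hΨ : Ψ.IsNormalized)
    {F : Smash q χ →ₗ[𝕜] Smash q χ →ₗ[𝕜] Smash q χ}
    (hF : VanishesOnGroup F) (hc : F ∈ hochschildCocycles 𝕜 (Smash q χ)) :
    Ψ.transfer (koszulPart (restrictSym F)) - F ∈ hochschildCoboundaries 𝕜 (Smash q χ) := by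
  have hγ := isCocycle_restrictSym hc
  have hκ := koszulPart_mem_koszulCocycles hq_diag hγ
  set γ := restrictSym F with hγF
  obtain ⟨h, hh⟩ := exists_eq_coboundary hq_diag hq_inv
    (γ := Ψ.pullback (koszulPart γ) - γ)
    ((smashAction q χ).cocycles.sub_mem (Ψ.isCocycle_pullback hκ) hγ) (by
      refine KCochain.ext_value fun i j hij => ?_
      have h1 := congrArg (fun κ => KCochain.value κ i j)
        (koszulPart_pullback hΨ (koszulPart γ))
      simp only [koszulPart_value _ hij] at h1
      rw [koszulPart_value _ hij, KCochain.value, map_zero, LinearMap.zero_apply]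
      simp only [LinearMap.sub_apply]
      rw [smul_sub, sub_sub_sub_comm, h1, sub_self])
  rw [sub_eq_iff_eq_add] at hh
  rw [transfer, hh, reynolds_add, theta_add, reynolds_coboundary,
    reynolds_of_isInvariant (hF.isInvariant_restrictSym hc), hF.theta_restrictSym hc,
    add_sub_cancel_right, theta_coboundary fun g a => conj_reynoldsOne _ g a]
  exact ⟨_, rfl⟩

end BarToKoszul

end

/-! ### The isomorphism in cohomology and the cocycle given by the two skew derivations -/

section

variable {𝕜 : Type u} [Field 𝕜] {G : Type v} [Group G] {k : ℕ}
  {q : Fin k → Fin k → 𝕜ˣ} {χ : Fin k → G →* 𝕜ˣ}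

theorem KoszulHH2.mk_eq_mk_iff {κ κ' : KCochain q χ 2} (hκ : κ ∈ koszulCocycles q χ)
    (hκ' : κ' ∈ koszulCocycles q χ) :
    KoszulHH2.mk κ hκ = KoszulHH2.mk κ' hκ' ↔ κ - κ' ∈ koszulCoboundaries q χ :=
  Submodule.Quotient.eq _

theorem HH2.mk_eq_mk_iff {A : Type*} [Ring A] [Algebra 𝕜 A] {f f' : A →ₗ[𝕜] A →ₗ[𝕜] A}
    (hf : f ∈ hochschildCocycles 𝕜 A) (hf' : f' ∈ hochschildCocycles 𝕜 A) :
    HH2.mk f hf = HH2.mk f' hf' ↔ f - f' ∈ hochschildCoboundaries 𝕜 A :=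
  Submodule.Quotient.eq _

theorem koszulAct_mem_koszulCocycles (g : G) {κ : KCochain q χ 2}
    (hκ : κ ∈ koszulCocycles q χ) : koszulAct q χ 2 g κ ∈ koszulCocycles q χ := by
  refine LinearMap.mem_ker.2 ?_
  rw [koszulDelta_act, LinearMap.mem_ker.1 hκ, map_zero]

theorem koszulHH2Act_mk (g : G) {κ : KCochain q χ 2} (hκ : κ ∈ koszulCocycles q χ) :
    koszulHH2Act q χ g (KoszulHH2.mk κ hκ) =
      KoszulHH2.mk (koszulAct q χ 2 g κ) (koszulAct_mem_koszulCocycles g hκ) := rfl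

theorem mk_mem_invariants_iff {κ : KCochain q χ 2} (hκ : κ ∈ koszulCocycles q χ) :
    KoszulHH2.mk κ hκ ∈ invariants q χ ↔
      ∀ g, koszulAct q χ 2 g κ - κ ∈ koszulCoboundaries q χ :=
  forall_congr' fun g => by rw [koszulHH2Act_mk, KoszulHH2.mk_eq_mk_iff]

theorem VanishesOnGroup.mk_mem_invariants (hq_diag : ∀ i, q i i = 1)
    {F : Smash q χ →ₗ[𝕜] Smash q χ →ₗ[𝕜] Smash q χ} (hF : VanishesOnGroup F)
    (hc : F ∈ hochschildCocycles 𝕜 (Smash q χ)) :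
    KoszulHH2.mk (koszulPart (restrictSym F))
      (koszulPart_mem_koszulCocycles hq_diag (isCocycle_restrictSym hc)) ∈ invariants q χ := by
  rw [mk_mem_invariants_iff]
  intro g
  rw [hF.koszulAct_koszulPart hc, sub_self]
  exact Submodule.zero_mem _

/-- The map induced by `θ₂* R₂ Ψ₂*` is an isomorphism from the invariants of
`HH²(S_q(V), S_q(V) # G)` to `HH²(S_q(V) # G)`. -/
theorem BarToKoszul.exists_transfer_equiv [Fintype G] [CharZero 𝕜] (hq_diag : ∀ i, q i i = 1)
    (hq_inv : ∀ i j, q j i = (q i j)⁻¹) {Ψ : BarToKoszul q χ} (hΨ : Ψ.IsNormalized) :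
    ∃ Θ : invariants q χ ≃ₗ[𝕜] HH2 𝕜 (Smash q χ),
      ∀ (κ : KCochain q χ 2) (hκ : κ ∈ koszulCocycles q χ)
        (hG : KoszulHH2.mk κ hκ ∈ invariants q χ),
        Θ ⟨KoszulHH2.mk κ hκ, hG⟩ =
          HH2.mk (Ψ.transfer κ) (Ψ.transfer_mem_hochschildCocycles hκ) := by
  let T : koszulCocycles q χ →ₗ[𝕜] hochschildCocycles 𝕜 (Smash q χ) :=
    Ψ.transferLin.restrict fun _ hκ => Ψ.transfer_mem_hochschildCocycles hκ
  let Θ : KoszulHH2 q χ →ₗ[𝕜] HH2 𝕜 (Smash q χ) := Submodule.mapQ _ _ T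
    fun _ hκ => Ψ.transfer_mem_hochschildCoboundaries hκ
  have hΘ : ∀ (κ : KCochain q χ 2) (hκ : κ ∈ koszulCocycles q χ), Θ (KoszulHH2.mk κ hκ) =
      HH2.mk (Ψ.transfer κ) (Ψ.transfer_mem_hochschildCocycles hκ) := fun _ _ => rfl
  refine ⟨LinearEquiv.ofBijective (Θ.domRestrict (invariants q χ)) ⟨?_, ?_⟩,
    fun κ hκ hG => hΘ κ hκ⟩
  · rw [← LinearMap.ker_eq_bot, LinearMap.ker_eq_bot']
    rintro ⟨x, hx⟩ h0
    obtain ⟨⟨κ, hκ⟩, rfl⟩ := Submodule.Quotient.mk_surjective _ x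
    have h1 : HH2.mk (Ψ.transfer κ) (Ψ.transfer_mem_hochschildCocycles hκ) =
        HH2.mk 0 (Submodule.zero_mem _) := h0
    rw [HH2.mk_eq_mk_iff, sub_zero] at h1
    have h2 := BarToKoszul.mem_koszulCoboundaries_of_transfer hq_diag hΨ
      ((mk_mem_invariants_iff hκ).1 hx) h1
    exact Subtype.ext ((Submodule.Quotient.mk_eq_zero _).2 h2)
  · intro y
    obtain ⟨⟨F, hF⟩, rfl⟩ := Submodule.Quotient.mk_surjective _ y
    obtain ⟨H, hH⟩ := exists_sub_vanishesOnGroup hF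
    have hc : F - hochschildDelta 𝕜 (Smash q χ) H ∈ hochschildCocycles 𝕜 (Smash q χ) :=
      Submodule.sub_mem _ hF (hochschildDelta_mem_hochschildCocycles H)
    refine ⟨⟨_, hH.mk_mem_invariants hq_diag hc⟩, ?_⟩
    refine (hΘ _ _).trans ((HH2.mk_eq_mk_iff _ hF).2 ?_)
    have h1 := Submodule.sub_mem _ (transfer_koszulPart_sub_mem hq_diag hq_inv hΨ hH hc)
      (⟨H, rfl⟩ : hochschildDelta 𝕜 (Smash q χ) H ∈ hochschildCoboundaries 𝕜 (Smash q χ))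
    rwa [sub_sub, sub_add_cancel] at h1

/-- The Leibniz rules are twisted by `σ` on opposite sides, so the term `D₁(a) σ(b) D₂(c)` occurs on
both sides of the identity. -/
theorem IsHopfModuleAlgebra.infinitesimal_mem_hochschildCocycles {A : Type*} [Ring A]
    [Algebra 𝕜 A] {t : 𝕜ˣ} {σ D₁ D₂ : A →ₗ[𝕜] A} (hH : IsHopfModuleAlgebra t σ D₁ D₂) :
    infinitesimal D₁ D₂ ∈ hochschildCocycles 𝕜 A := by
  intro a b c
  change a * (D₁ b * D₂ c) + D₁ a * D₂ (b * c) = D₁ (a * b) * D₂ c + D₁ a * D₂ b * c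
  rw [hH.D₂_mul, hH.D₁_mul]
  simp only [mul_add, add_mul, mul_assoc]
  abel

/-- The Koszul part of `m ∘ (D₁ ⊗ D₂)`, when `D₁` and `D₂` each have one generator outside their
kernels. -/
theorem koszulPart_infinitesimal {D₁ D₂ : Smash q χ →ₗ[𝕜] Smash q χ} {i₁ i₂ : Fin k}
    (h : i₁ < i₂) (h₁ : ∀ j, j ≠ i₁ → D₁ (incl q χ (gen q χ j)) = 0)
    (h₂ : ∀ j, j ≠ i₂ → D₂ (incl q χ (gen q χ j)) = 0) :
    koszulPart (restrictSym (infinitesimal D₁ D₂)) =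
      wedgeDual q χ (D₁ (incl q χ (gen q χ i₁)) * D₂ (incl q χ (gen q χ i₂))) i₁ i₂ h := by
  refine KCochain.ext_value fun i j hij => ?_
  have hv : ∀ a b, restrictSym (infinitesimal D₁ D₂) a b =
      D₁ (incl q χ a) * D₂ (incl q χ b) := fun _ _ => rfl
  rw [koszulPart_value _ hij, KCochain.value_of_lt _ hij, hv, hv]
  -- A nonzero product would need `j = i₁` and `i = i₂`, against `i < j` and `i₁ < i₂`.
  have h0 : D₁ (incl q χ (gen q χ j)) * D₂ (incl q χ (gen q χ i)) = 0 := by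
    by_cases hj : j = i₁
    · rw [h₂ i (by rintro rfl; exact absurd (hj ▸ hij) h.not_gt), mul_zero]
    · rw [h₁ j hj, zero_mul]
  rw [h0, smul_zero, sub_zero]
  by_cases hi : i = i₁ ∧ j = i₂
  · obtain ⟨rfl, rfl⟩ := hi
    rw [wedgeDual, Pi.single_eq_same]
  · rw [wedgeDual, Pi.single_eq_of_ne]
    · by_cases h' : i = i₁
      · rw [h₂ j fun h'' => hi ⟨h', h''⟩, mul_zero]
      · rw [h₁ i h', zero_mul]
    · intro he
      have he' : ({i, j} : Finset (Fin k)) = {i₁, i₂} := congrArg Subtype.val he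
      have hi' : i ∈ ({i₁, i₂} : Finset (Fin k)) := he' ▸ by simp
      have hj' : j ∈ ({i₁, i₂} : Finset (Fin k)) := he' ▸ by simp
      simp only [Finset.mem_insert, Finset.mem_singleton] at hi' hj'
      refine hi ?_
      rcases hi' with rfl | rfl <;> rcases hj' with rfl | rfl
      · exact absurd hij (lt_irrefl _)
      · exact ⟨rfl, rfl⟩
      · exact absurd hij h.not_gt
      · exact absurd hij (lt_irrefl _)

end

end

end QuantumSmash
theorem mainTheorem6 {𝕜 : Type*} [Field 𝕜] [CharZero 𝕜] {G : Type*} [Group G] [Fintype G]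
    {k : ℕ} (hk : 3 ≤ k)
    -- the parameters of the quantum symmetric algebra and the diagonal action of the group
    (q : Fin k → Fin k → 𝕜ˣ) (hq_diag : ∀ i, q i i = 1) (hq_inv : ∀ i j, q j i = (q i j)⁻¹)
    (χ : Fin k → G →* 𝕜ˣ)
    -- the indices of the first two basis vectors
    (i₁ i₂ : Fin k) (hi₁ : i₁.val = 0) (hi₂ : i₂.val = 1)
    -- the module algebra structure over the Hopf algebra with parameter `t`
    (t : 𝕜ˣ) (σ D₁ D₂ : Smash q χ →ₗ[𝕜] Smash q χ) (hH : IsHopfModuleAlgebra t σ D₁ D₂)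
    (lam : Fin k → 𝕜ˣ)
    (hσ_gen : ∀ i, σ (incl q χ (gen q χ i)) = (lam i : 𝕜) • incl q χ (gen q χ i))
    (ξ : G →* 𝕜ˣ) (hσ_grp : ∀ g, σ (grp q χ g) = (ξ g : 𝕜) • grp q χ g)
    (P₁ P₂ : QSym q χ) (g₁ g₂ : G)
    (hP₁ : ∀ j, j ≠ i₁ → ∃ c : 𝕜, P₁ * gen q χ j = c • (gen q χ j * P₁))
    (hP₂ : ∀ j, j ≠ i₂ → ∃ c : 𝕜, P₂ * gen q χ j = c • (gen q χ j * P₂))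
    (hD₁_gen : D₁ (incl q χ (gen q χ i₁)) = incl q χ P₁ * grp q χ g₁)
    (hD₁_zero : ∀ j, j ≠ i₁ → D₁ (incl q χ (gen q χ j)) = 0)
    (hD₁_grp : ∀ g, D₁ (grp q χ g) = 0)
    (hD₂_gen : D₂ (incl q χ (gen q χ i₂)) = incl q χ P₂ * grp q χ g₂)
    (hD₂_zero : ∀ j, j ≠ i₂ → D₂ (incl q χ (gen q χ j)) = 0)
    (hD₂_grp : ∀ g, D₂ (grp q χ g) = 0)
    (hP₁_mem : P₁ ∈ Algebra.adjoin 𝕜 {x | ∃ j : Fin k, 2 ≤ j.val ∧ x = gen q χ j})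
    (hP₂_mem : P₂ ∈ Algebra.adjoin 𝕜 {x | ∃ j : Fin k, 2 ≤ j.val ∧ x = gen q χ j}) :
    -- chain maps with the prescribed values on generators exist, and for each of them
    (∃ Ψ : BarToKoszul q χ, Ψ.IsNormalized) ∧
    ∀ Ψ : BarToKoszul q χ, Ψ.IsNormalized →
      -- the map `κ ↦ θ₂* R₂ Ψ₂* κ` induces an isomorphism `Θ` in cohomology
      ∃ Θ : invariants q χ ≃ₗ[𝕜] HH2 𝕜 (Smash q χ),
        (∀ (κ : KCochain q χ 2) (hκ : κ ∈ koszulCocycles q χ)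
            (hG : KoszulHH2.mk κ hκ ∈ invariants q χ),
          ∃ hc : Ψ.transfer κ ∈ hochschildCocycles 𝕜 (Smash q χ),
            Θ ⟨KoszulHH2.mk κ hκ, hG⟩ = HH2.mk (Ψ.transfer κ) hc) ∧
        -- that takes the class of `P₁ g₁ P₂ g₂ ⊗ w₁* ∧ w₂*` to the class of `m ∘ (D₁ ⊗ D₂)`
        ∃ (hκ : wedgeDual q χ (incl q χ P₁ * grp q χ g₁ * (incl q χ P₂ * grp q χ g₂)) i₁ i₂
              (Fin.lt_def.2 (by omega)) ∈ koszulCocycles q χ)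
          (hG : KoszulHH2.mk _ hκ ∈ invariants q χ)
          (hμ : infinitesimal D₁ D₂ ∈ hochschildCocycles 𝕜 (Smash q χ)),
          Θ ⟨KoszulHH2.mk _ hκ, hG⟩ = HH2.mk (infinitesimal D₁ D₂) hμ := by
  refine ⟨exists_barToKoszul χ hq_diag hq_inv, fun Ψ hΨ => ?_⟩
  obtain ⟨Θ, hΘ⟩ := BarToKoszul.exists_transfer_equiv hq_diag hq_inv hΨ
  refine ⟨Θ, fun κ hκ hG => ⟨Ψ.transfer_mem_hochschildCocycles hκ, hΘ κ hκ hG⟩, ?_⟩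
  have hlt : i₁ < i₂ := Fin.lt_def.2 (by omega)
  have hc := hH.infinitesimal_mem_hochschildCocycles
  have hv : VanishesOnGroup (infinitesimal D₁ D₂) := fun x g => by
    change D₁ x * D₂ (grp q χ g) = 0 ∧ D₁ (grp q χ g) * D₂ x = 0
    rw [hD₁_grp, hD₂_grp, mul_zero, zero_mul]
    exact ⟨rfl, rfl⟩
  -- Once the element is recognized as the Koszul part of `μ₁`, its cocycle property and the
  -- invariance of its class follow from those of `μ₁`.
  have hp := koszulPart_infinitesimal hlt hD₁_zero hD₂_zero
  rw [hD₁_gen, hD₂_gen] at hp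
  rw [← hp]
  refine ⟨koszulPart_mem_koszulCocycles hq_diag (isCocycle_restrictSym hc),
    hv.mk_mem_invariants hq_diag hc, hc, ?_⟩
  rw [hΘ, HH2.mk_eq_mk_iff]
  exact BarToKoszul.transfer_koszulPart_sub_mem hq_diag hq_inv hΨ hv hc
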